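/- **Setting.** Let $n>2$, $a>0$, and let $\rho$ be a Borel measure on $\mathbb R$ with $0<\int_{\mathbb R}e^{a|u|^n}\,d\rho(u)<\infty$; for $b\in\mathbb R$ let $d\rho_b(u)=e^{b|u|^n}d\rho(u)$. Let $V$ be a countable set and let $J=(J_{x,y})_{x,y\in V}$ be real interactions. Call $J$ *admissible* with data $(f,\delta_f,M_f)$, where $f:\mathbb R\to[1,\infty)$ and $\delta_f,M_f>0$, if $J_{x,y}=J_{y,x}$ for all $x,y$; $f(t)\ge \bigl(\max\{\log(|t|^{-1}),0\}\bigr)^{1/n}$ for all $t\ne0$ with $|t|<\delta_f$; and $\sum_{y\in V}|J_{x,y}|f(J_{x,y})\le M_f$ for all $x\in V$. For finite $\Lambda\subset V$, $\beta\ge0$ and $\xi\in\mathbb R^V$ with $\sum_{y\in V}|J_{x,y}\xi_y|<\infty$ for all $x\in\Lambda$, let $$d\nu^{\xi}_{\Lambda,\beta,\rho,J}[\varphi]=\frac1{Z^{\xi}_{\Lambda,\beta,\rho,J}}\,e^{-\beta H^{\xi}_{\Lambda,J}(\varphi)}\prod_{x\in\Lambda}d\rho(\varphi_x),\qquad H^{\xi}_{\Lambda,J}(\varphi)=-\sum_{\{x,y\}\subset\Lambda,\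 x\neq y}J_{x,y}\varphi_x\varphi_y-\sum_{x\in\Lambda}\sum_{y\in V\setminus\Lambda}J_{x,y}\varphi_x\xi_y,$$ where $Z^{\xi}_{\Lambda,\beta,\rho,J}$ is the normalising constant. For $C\ge1$, finite $\Lambda\subset V$ and $x\in\Lambda$, let $A(x,\Lambda,\xi,C)$ be the smallest $A\ge1$ (and $\infty$ if there is none) such that for every $m\ge0$ and every sequence $x_0=x,x_1,\dots,x_m$ of vertices of $\Lambda$ with $J_{x_{i-1},x_i}\ne0$ for $1\le i\le m$, $$\Bigl|\sum_{z\in V\setminus\Lambda}J_{x_m,z}\xi_z\Bigr|\le\Bigl(\sum_{z\in V\setminus\Lambda}|J_{x_m,z}|f(J_{x_m,z})\Bigr)\,C\,A^{(n-1)^{m+1}}\prod_{i=1}^m f(J_{x_{i-1},x_i})^{(n-1)^{m+1-i}}.$$ **Theorem.** Given $n$, $a$, $\rho$ as above and $\delta_f,M_f>0$, there are constants $C_1\ge0$, $C_2\ge1$, $\tilde C_1\ge0$, $\tilde C_2>0$, depending only on $n,a,\rho,\delta_f,M_f$, such that the following holds for every countable set $V$, all interactions $J$ on $V$ that are admissible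 with data $(f,\delta_f,M_f)$ for some $f$ (this $f$ being used in the definition of $A$), and every $\beta\ge0$. Put $$C=C_1\beta^{\frac1{n-2}}+C_2,\qquad \tilde C=\tilde C_1\beta^{\frac n{n-2}}+\tilde C_2 .$$ For all finite $\Lambda\subset V$, all $\Lambda'\subset\Lambda$ and every $\xi\in\mathbb R^V$ with $\sum_{y\in V}|J_{x,y}\xi_y|<\infty$ for all $x\in\Lambda$: the probability measure $\nu^{\xi}_{\Lambda,\beta,\rho,J}$ is well defined, $A(x,\Lambda,\xi,C)<\infty$ for all $x\in\Lambda$, and $$d\nu^{\xi}_{\Lambda,\beta,\rho,J}[\varphi|_{\Lambda'}=\psi]\le\Bigl(\prod_{x\in\Lambda'}e^{\tilde C A(x,\Lambda,\xi,C)^n}\Bigr)\,d\nu^{0}_{\Lambda',0,\rho_{a/2},0}[\psi],$$ as an inequality between measures on $\mathbb R^{\Lambda'}$, where the left-hand side is the law of $\varphi|_{\Lambda'}$ under $\nu^{\xi}_{\Lambda,\beta,\rho,J}$ and $\nu^{0}_{\Lambda',0,\rho_{a/2},0}$ is the product over $\Lambda'$ of the measure $\rho_{a/2}$ normalised to be a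 probability measure. -/

import Mathlib

open scoped ENNReal

universe u

noncomputable section

namespace SpinRegularity

/-- The interactions `J` on `V` are admissible (for the exponent `n`), with `f`, `δ` and `M` as
witnesses of the integrability condition. The lower bound on `f t` only concerns `t ≠ 0`, since
`log (|t|⁻¹) = ∞` at `t = 0`, and it is empty for `|t| ≥ 1`, where `log (|t|⁻¹) ≤ 0`
(hence the positive part). -/
structure IsAdmissible {V : Type u} (n : ℝ) (J : V → V → ℝ) (f : ℝ → ℝ) (δ M : ℝ) : Prop where
  symm : ∀ x y, J x y = J y x
  δ_pos : 0 < δ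
  M_pos : 0 < M
  one_le : ∀ t, 1 ≤ f t
  log_le : ∀ t, t ≠ 0 → |t| < δ → (max (Real.log |t|⁻¹) 0) ^ (1 / n) ≤ f t
  summable : ∀ x, Summable fun y => |J x y| * f (J x y)
  tsum_le : ∀ x, ∑' y, |J x y| * f (J x y) ≤ M

/-- The measure `ρ_b`, with density `exp (b |u| ^ n)` with respect to `ρ`. -/
def tilt (ρ : MeasureTheory.Measure ℝ) (b n : ℝ) : MeasureTheory.Measure ℝ :=
  ρ.withDensity fun u => ENNReal.ofReal (Real.exp (b * |u| ^ n))

open Classical in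
/-- The Hamiltonian on `Λ` with interactions `J` and boundary condition `ξ`. For symmetric `J`,
half of the sum over ordered pairs of distinct vertices of `Λ` is the sum over unordered pairs. -/
def hamiltonian {V : Type u} (Λ : Finset V) (J : V → V → ℝ) (ξ : V → ℝ) (φ : Λ → ℝ) : ℝ :=
  - ((1 / 2) * ∑ x : Λ, ∑ y : Λ, if x = y then 0 else J x y * φ x * φ y)
    - ∑ x : Λ, ∑' y : {y : V // y ∉ Λ}, J x y * φ x * ξ y

/-- The partition function. -/
def partitionFunction {V : Type u} (Λ : Finset V) (β : ℝ) (ρ : MeasureTheory.Measure ℝ)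
    (J : V → V → ℝ) (ξ : V → ℝ) : ℝ≥0∞ :=
  ∫⁻ φ, ENNReal.ofReal (Real.exp (-β * hamiltonian Λ J ξ φ))
    ∂(MeasureTheory.Measure.pi fun _ : Λ => ρ)

/-- The finite-volume spin model on `Λ`, a measure on `ℝ ^ Λ`. -/
def gibbs {V : Type u} (Λ : Finset V) (β : ℝ) (ρ : MeasureTheory.Measure ℝ)
    (J : V → V → ℝ) (ξ : V → ℝ) : MeasureTheory.Measure (Λ → ℝ) :=
  (partitionFunction Λ β ρ J ξ)⁻¹ •
    (MeasureTheory.Measure.pi fun _ : Λ => ρ).withDensity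
      fun φ => ENNReal.ofReal (Real.exp (-β * hamiltonian Λ J ξ φ))

/-- The sequence `w 0, …, w m` is a walk from `S` to `T` whose interior vertices lie in `R`
and whose steps all have nonzero interaction (the values `w i` with `i > m` play no role). -/
def IsWalk {V : Type u} (J : V → V → ℝ) (R S T : Set V) (m : ℕ) (w : ℕ → V) : Prop :=
  w 0 ∈ S ∧ w m ∈ T ∧ (∀ i, 0 < i → i < m → w i ∈ R) ∧ ∀ i, i < m → J (w i) (w (i + 1)) ≠ 0

/-- The external field `h_{x,R}` exerted on `x` by the boundary condition outside `R`. -/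
def boundaryField {V : Type u} (J : V → V → ℝ) (ξ : V → ℝ) (R : Set V) (x : V) : ℝ :=
  ∑' y : {y : V // y ∉ R}, J x y * ξ y

/-- The real numbers `A ≥ 1` among which `A(x, R, ξ, C)` is the smallest. The factor of index
`i` in the product is that of the `(i + 1)`-st step of the walk, so that its exponent is
`(n - 1) ^ (m + 1 - (i + 1))`. -/
def AdmitsBound {V : Type u} (n : ℝ) (J : V → V → ℝ) (f : ℝ → ℝ) (ξ : V → ℝ) (C : ℝ)
    (R : Set V) (x : V) (A : ℝ) : Prop :=
  1 ≤ A ∧ ∀ y ∈ R, ∀ (m : ℕ) (w : ℕ → V), IsWalk J R {x} {y} m w →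
    |boundaryField J ξ R y| ≤
      (∑' z : {z : V // z ∉ R}, |J y z| * f (J y z)) * C * A ^ ((n - 1) ^ (m + 1)) *
        ∏ i ∈ Finset.range m, f (J (w i) (w (i + 1))) ^ ((n - 1) ^ (m - i))

/-- The function `A(x, R, ξ, C)`; it is `∞` if there is no admissible `A`. The conditions on `A`
are closed, so that the infimum is a minimum if it is finite. -/
def boundaryGrowth {V : Type u} (n : ℝ) (J : V → V → ℝ) (f : ℝ → ℝ) (ξ : V → ℝ) (C : ℝ)
    (R : Set V) (x : V) : ℝ≥0∞ :=
  ⨅ (A : ℝ) (_ : AdmitsBound n J f ξ C R x A), ENNReal.ofReal A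

end SpinRegularity

end

open MeasureTheory Function

namespace SpinRegularity

/-! ### Jensen's inequality, superquadratic growth and product measures -/

section Elementary

/-! The engine is a first-moment bound, `momentBound`: in any finite region with any summable
boundary condition, the spin at `y` has first absolute moment at most `C * A` for every admissible
growth constant `A` at `y`, with one `C` for all regions. It is proved by induction on the number of
sites. The law of the spins on an arbitrary set `S` then follows by the same computation as the
induction step, with `R` the rest of the region.

Integrating out `R` leaves a density on `S` equal to an explicit Boltzmann factor times the
partition function of `R` with the spins of `S` as boundary values. Changing one boundary spin
perturbs the energy in `R` linearly, so by Jensen the logarithm of the partition function changes by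
at most `β` times a sum of first moments in `R`. These are controlled by the moment bound, since
growth constants propagate: crossing an edge from `x` to `y` replaces `A` by `(A ^ (n - 1) + t / C)
* f (J x y)`, where `t` bounds the spins on `S` (`AdmitsBound.of_adj`). The factor `f` is paid for
by the summability of `|J| * f(J)`. Switching on the spins of `S` in increasing order of absolute
value lets `t` be the modulus of the spin being changed, so the total cost is a sum of single-site
terms (`partitionFunction_glue_comparison`).

With `β * M ≤ ε * C ^ (n - 2)`, all these terms, including the energy inside `S` and the outer
field, are at most `4 * ε * ((C * A) ^ n + |ψ x| ^ n)` per site. Hence the density is constant up to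
the exponential of such a sum (`marginalWeight_comparison`), and restricting the spins to `[-L, L]`
bounds the partition function from below (`lintegral_marginal_le`).

For one site, spins below `C * A / 2` contribute at most half of the desired moment. Above it, `(C *
A) ^ n` is absorbed into `|u| ^ n`, so for small `ε` the tail is integrable against `exp (a / 2 *
|u| ^ n)`, and a large `C` makes it at most the other half. The induction thus closes without loss
in `C`. -/

/-- Jensen for `exp`, by integrating the tangent line at `-m`. The negative term of the tangent is
moved to the other side, so that no subtraction occurs in `ℝ≥0∞`. -/
theorem lintegral_exp_neg_ge {α : Type*} [MeasurableSpace α] (μ : Measure α) (X : α → ℝ)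
    (hX : Measurable X) (hX0 : ∀ φ, 0 ≤ X φ) (m : ℝ) (hm : 0 ≤ m) (hμ : μ Set.univ ≠ ∞)
    (hint : ∫⁻ φ, ENNReal.ofReal (X φ) ∂μ ≤ ENNReal.ofReal m * μ Set.univ) :
    ENNReal.ofReal (Real.exp (-m)) * μ Set.univ ≤ ∫⁻ φ, ENNReal.ofReal (Real.exp (-X φ)) ∂μ := by
  have key : ∫⁻ _, ENNReal.ofReal (Real.exp (-m) * (1 + m)) ∂μ ≤
      ∫⁻ φ, ENNReal.ofReal (Real.exp (-X φ)) ∂μ +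
        ENNReal.ofReal (Real.exp (-m)) * ∫⁻ φ, ENNReal.ofReal (X φ) ∂μ := by
    rw [← lintegral_const_mul _ (by fun_prop), ← lintegral_add_left (by fun_prop)]
    refine lintegral_mono fun φ => ?_
    rw [← ENNReal.ofReal_mul (Real.exp_pos _).le,
      ← ENNReal.ofReal_add (Real.exp_pos _).le (mul_nonneg (Real.exp_pos _).le (hX0 φ))]
    apply ENNReal.ofReal_le_ofReal
    have h1 : Real.exp (-X φ) = Real.exp (-m) * Real.exp (m - X φ) := by
      rw [← Real.exp_add]; ring_nf
    rw [h1]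
    have h2 := Real.add_one_le_exp (m - X φ)
    nlinarith [Real.exp_pos (-m)]
  rw [lintegral_const, mul_add, mul_one,
    ENNReal.ofReal_add (Real.exp_pos _).le (mul_nonneg (Real.exp_pos _).le hm), add_mul,
    ENNReal.ofReal_mul (Real.exp_pos _).le] at key
  have h3 := key.trans (add_le_add_right (mul_le_mul_right hint _) _)
  rw [← mul_assoc] at h3
  exact (ENNReal.add_le_add_iff_right (ENNReal.mul_ne_top
    (ENNReal.mul_ne_top ENNReal.ofReal_ne_top ENNReal.ofReal_ne_top) hμ)).1 h3

theorem exists_quadratic_le_rpow {n a : ℝ} (hn : 2 < n) (ha : 0 < a) (c : ℝ) (hc : 0 ≤ c) :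
    ∃ k, ∀ u : ℝ, c * (u ^ 2 + |u|) ≤ a * |u| ^ n + k := by
  obtain ⟨T, hT1, hT⟩ : ∃ T : ℝ, 1 ≤ T ∧ 2 * c / a ≤ T ^ (n - 2) := by
    have := (tendsto_rpow_atTop (show 0 < n - 2 by linarith)).eventually_ge_atTop (2 * c / a)
    obtain ⟨T, h⟩ := (this.and (Filter.eventually_ge_atTop 1)).exists
    exact ⟨T, h.2, h.1⟩
  refine ⟨c * (T ^ 2 + T), fun u => ?_⟩
  rw [← sq_abs]
  set t := |u| with ht
  have ht0 : 0 ≤ t := abs_nonneg u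
  rcases le_total t T with h | h
  · have : c * (t ^ 2 + t) ≤ c * (T ^ 2 + T) := by gcongr
    have h2 : 0 ≤ a * t ^ n := by positivity
    linarith
  · have h1 : T ^ (n - 2) ≤ t ^ (n - 2) := Real.rpow_le_rpow (by linarith) h (by linarith)
    have h2 : t ^ n = t ^ (n - 2) * t ^ 2 := by
      rw [← Real.rpow_natCast, ← Real.rpow_add (by linarith)]; norm_num
    have h3 : 2 * c ≤ t ^ (n - 2) * a := (div_le_iff₀ ha).1 (hT.trans h1)
    have h4 : t ≤ t ^ 2 := by nlinarith
    have h5 : 0 ≤ c * (T ^ 2 + T) := by positivity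
    have h6 : c * t ≤ c * t ^ 2 := by gcongr
    rw [h2]
    nlinarith [mul_le_mul_of_nonneg_right h3 (sq_nonneg t)]

theorem lmarginal_prod {ι : Type*} [DecidableEq ι] (ρ : Measure ℝ) [SigmaFinite ρ] (s : Finset ι)
    (g : ι → ℝ → ℝ≥0∞) (hg : ∀ i, Measurable (g i)) (x : ι → ℝ) :
    lmarginal (fun _ => ρ) s (fun Φ => ∏ i ∈ s, g i (Φ i)) x = ∏ i ∈ s, ∫⁻ u, g i u ∂ρ := by
  induction s using Finset.induction generalizing x with
  | empty => simp
  | insert i s hi ih =>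
    have hm : ∀ t : Finset ι, Measurable fun Φ : ι → ℝ => ∏ i ∈ t, g i (Φ i) := fun t =>
      Finset.measurable_fun_prod _ fun i _ => (hg i).comp (measurable_pi_apply i)
    rw [lmarginal_insert' _ (hm _) hi, Finset.prod_insert hi, ← ih x]
    have : (fun x : ι → ℝ => ∫⁻ u, ∏ j ∈ insert i s, g j (update x i u j) ∂ρ) =
        fun x => (∫⁻ u, g i u ∂ρ) * ∏ j ∈ s, g j (x j) := by
      funext x
      rw [← lintegral_mul_const _ (hg i)]
      refine lintegral_congr fun u => ?_
      rw [Finset.prod_insert hi, update_self]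
      congr 1
      refine Finset.prod_congr rfl fun j hj => ?_
      rw [update_of_ne (by rintro rfl; exact hi hj)]
    rw [this]
    unfold lmarginal
    rw [lintegral_const_mul]
    exact (hm s).comp measurable_updateFinset

theorem lintegral_pi_prod {ι : Type*} [Fintype ι] (ρ : Measure ℝ) [SigmaFinite ρ]
    (g : ι → ℝ → ℝ≥0∞) (hg : ∀ i, Measurable (g i)) :
    ∫⁻ φ : ι → ℝ, ∏ i, g i (φ i) ∂(Measure.pi fun _ => ρ) = ∏ i, ∫⁻ u, g i u ∂ρ := by
  classical
  rw [lintegral_eq_lmarginal_univ (μ := fun _ : ι => ρ) (f := fun φ : ι → ℝ => ∏ i, g i (φ i)) 0,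
    lmarginal_prod ρ _ g hg 0]

theorem pi_withDensity {ι : Type*} [Fintype ι] (ρ : Measure ℝ) [SigmaFinite ρ] (g : ℝ → ℝ≥0∞)
    (hg : Measurable g) [SigmaFinite (ρ.withDensity g)] :
    (Measure.pi fun _ : ι => ρ.withDensity g) =
      (Measure.pi fun _ => ρ).withDensity fun φ => ∏ i, g (φ i) := by
  refine Measure.pi_eq fun s hs => ?_
  simp only [withDensity_apply _ (MeasurableSet.univ_pi hs), withDensity_apply _ (hs _)]
  simp only [← lintegral_indicator (hs _)]
  rw [← lintegral_pi_prod ρ (fun i => (s i).indicator g) (fun i => hg.indicator (hs i)),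
    ← lintegral_indicator (MeasurableSet.univ_pi hs)]
  refine lintegral_congr fun φ => ?_
  by_cases h : φ ∈ Set.univ.pi s
  · rw [Set.indicator_of_mem h]
    exact Finset.prod_congr rfl fun i _ => (Set.indicator_of_mem (h i trivial) g).symm
  · rw [Set.indicator_of_notMem h]
    obtain ⟨i, hi⟩ : ∃ i, φ i ∉ s i := by simpa using h
    exact (Finset.prod_eq_zero (Finset.mem_univ i) (Set.indicator_of_notMem hi g)).symm

end Elementary

/-! ### Splitting the energy between two disjoint sets of sites -/

section Hamiltonian

theorem boundaryField_congr {V : Type u} (J : V → V → ℝ) {ξ ζ : V → ℝ} (R : Set V) (x : V)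
    (h : ∀ z, z ∉ R → ξ z = ζ z) : boundaryField J ξ R x = boundaryField J ζ R x :=
  tsum_congr fun z => by rw [h z z.2]

variable {V : Type u} [DecidableEq V]

/-- The interaction energy of the spins in `S`, as a sum over unordered pairs. -/
noncomputable def pairEnergy (S : Finset V) (J : V → V → ℝ) (Φ : V → ℝ) : ℝ :=
  (1 / 2) * ∑ x ∈ S, ∑ y ∈ S, if x = y then 0 else J x y * Φ x * Φ y

theorem hamiltonian_restrict (Λ : Finset V) (J : V → V → ℝ) (ξ Φ : V → ℝ) :
    hamiltonian Λ J ξ (Λ.restrict Φ) =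
      - pairEnergy Λ J Φ - ∑ x ∈ Λ, Φ x * boundaryField J ξ (Λ : Set V) x := by
  unfold hamiltonian pairEnergy boundaryField
  congr 1
  · congr 2
    rw [← Finset.sum_coe_sort Λ]
    refine Finset.sum_congr rfl fun x _ => ?_
    rw [← Finset.sum_coe_sort Λ]
    refine Finset.sum_congr rfl fun y _ => ?_
    by_cases h : x = y
    · simp [h]
    · simp [h, Subtype.coe_injective.ne h]
  · rw [← Finset.sum_coe_sort Λ]
    refine Finset.sum_congr rfl fun x _ => ?_
    rw [← tsum_mul_left]
    refine tsum_congr fun y => ?_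
    simp only [Finset.restrict]
    ring

theorem restrict_updateFinset_self (Λ : Finset V) (ξ : V → ℝ) (φ : Λ → ℝ) :
    Λ.restrict (updateFinset ξ Λ φ) = φ :=
  restrict_updateFinset (π := fun _ : V => ℝ) ξ φ

theorem measurable_updateFinset_apply (Λ : Finset V) (ξ : V → ℝ) (v : V) :
    Measurable fun φ : Λ → ℝ => updateFinset ξ Λ φ v :=
  (measurable_pi_apply v).comp (measurable_updateFinset (X := fun _ : V => ℝ))

theorem measurable_hamiltonian (Λ : Finset V) (J : V → V → ℝ) (ξ : V → ℝ) :
    Measurable (hamiltonian Λ J ξ) := by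
  -- Extending `φ` by zero gives access to the formula for configurations on all of `V`; the
  -- extension does not affect the energy.
  have h : hamiltonian Λ J ξ = fun φ : Λ → ℝ =>
      hamiltonian Λ J ξ (Λ.restrict (updateFinset (0 : V → ℝ) Λ φ)) := by
    funext φ
    rw [restrict_updateFinset_self]
  rw [h]
  simp only [hamiltonian_restrict, pairEnergy]
  have hm : ∀ v, Measurable fun φ : Λ → ℝ => updateFinset (0 : V → ℝ) Λ φ v := fun v =>
    measurable_updateFinset_apply Λ 0 v
  refine Measurable.sub (Measurable.neg (Measurable.const_mul ?_ _)) ?_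
  · refine Finset.measurable_fun_sum _ fun x _ => Finset.measurable_fun_sum _ fun y _ => ?_
    split_ifs
    · exact measurable_const
    · exact ((hm x).const_mul _).mul (hm y)
  · exact Finset.measurable_fun_sum _ fun x _ => (hm x).mul_const _

theorem boundaryField_eq_add {J : V → V → ℝ} {ζ : V → ℝ} {S R : Finset V} (hSR : Disjoint S R)
    {y : V} (hs : Summable fun z => J y z * ζ z) :
    boundaryField J ζ (R : Set V) y =
      boundaryField J ζ ((S ∪ R : Finset V) : Set V) y + ∑ x ∈ S, J y x * ζ x := by
  have h1 := hs.sum_add_tsum_compl (s := R)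
  have h2 := hs.sum_add_tsum_compl (s := S ∪ R)
  rw [Finset.sum_union hSR] at h2
  change _ + boundaryField J ζ (R : Set V) y = _ at h1
  change _ + boundaryField J ζ ((S ∪ R : Finset V) : Set V) y = _ at h2
  linarith

theorem pairEnergy_union {J : V → V → ℝ} (hJ : ∀ x y, J x y = J y x) {S R : Finset V}
    (hSR : Disjoint S R) (Φ : V → ℝ) :
    pairEnergy (S ∪ R) J Φ = pairEnergy S J Φ + pairEnergy R J Φ +
      ∑ y ∈ R, Φ y * ∑ x ∈ S, J y x * Φ x := by
  unfold pairEnergy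
  simp only [Finset.sum_union hSR, Finset.sum_add_distrib]
  have h1 : ∑ x ∈ S, ∑ y ∈ R, (if x = y then 0 else J x y * Φ x * Φ y) =
      ∑ y ∈ R, Φ y * ∑ x ∈ S, J y x * Φ x := by
    rw [Finset.sum_comm]
    refine Finset.sum_congr rfl fun y hy => ?_
    rw [Finset.mul_sum]
    refine Finset.sum_congr rfl fun x hx => ?_
    rw [if_neg (by rintro rfl; exact Finset.disjoint_left.1 hSR hx hy), hJ x y]
    ring
  have h2 : ∑ x ∈ R, ∑ y ∈ S, (if x = y then 0 else J x y * Φ x * Φ y) =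
      ∑ y ∈ R, Φ y * ∑ x ∈ S, J y x * Φ x := by
    refine Finset.sum_congr rfl fun y hy => ?_
    rw [Finset.mul_sum]
    refine Finset.sum_congr rfl fun x hx => ?_
    rw [if_neg (by rintro rfl; exact Finset.disjoint_left.1 hSR hx hy)]
    ring
  rw [h1, h2]
  ring

theorem pairEnergy_congr (J : V → V → ℝ) {S : Finset V} {Φ Ψ : V → ℝ} (h : ∀ x ∈ S, Φ x = Ψ x) :
    pairEnergy S J Φ = pairEnergy S J Ψ := by
  unfold pairEnergy
  congr 1
  refine Finset.sum_congr rfl fun x hx => Finset.sum_congr rfl fun y hy => ?_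
  rw [h x hx, h y hy]

/-- The cross terms between `S` and `R` are exactly the part of the field on `R` that comes from the
values of `ζ` on `S`. Once `ζ` is fixed, what remains depends only on `S`. -/
theorem hamiltonian_union {J : V → V → ℝ} (hJ : ∀ x y, J x y = J y x) {S R : Finset V}
    (hSR : Disjoint S R) {ξ ζ : V → ℝ} (hζ : ∀ z, z ∉ S ∪ R → ζ z = ξ z)
    (hs : ∀ y ∈ R, Summable fun z => J y z * ζ z) (φ : R → ℝ) :
    hamiltonian (S ∪ R) J ξ ((S ∪ R).restrict (updateFinset ζ R φ)) =
      hamiltonian R J ζ φ - pairEnergy S J ζ -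
        ∑ x ∈ S, ζ x * boundaryField J ξ ((S ∪ R : Finset V) : Set V) x := by
  have hS : ∀ x ∈ S, updateFinset ζ R φ x = ζ x := fun x hx => by
    simp [updateFinset, Finset.disjoint_left.1 hSR hx]
  have h0 : hamiltonian R J ζ φ = hamiltonian R J ζ (R.restrict (updateFinset ζ R φ)) := by
    rw [restrict_updateFinset_self]
  rw [h0, hamiltonian_restrict, hamiltonian_restrict, pairEnergy_union hJ hSR, Finset.sum_union hSR,
    pairEnergy_congr J hS]
  have h1 : ∑ x ∈ S, updateFinset ζ R φ x * boundaryField J ξ ((S ∪ R : Finset V) : Set V) x =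
      ∑ x ∈ S, ζ x * boundaryField J ξ ((S ∪ R : Finset V) : Set V) x :=
    Finset.sum_congr rfl fun x hx => by rw [hS x hx]
  have h2 : ∑ y ∈ R, updateFinset ζ R φ y * boundaryField J ζ (R : Set V) y =
      ∑ y ∈ R, updateFinset ζ R φ y * boundaryField J ξ ((S ∪ R : Finset V) : Set V) y +
      ∑ y ∈ R, updateFinset ζ R φ y * ∑ x ∈ S, J y x * updateFinset ζ R φ x := by
    rw [← Finset.sum_add_distrib]
    refine Finset.sum_congr rfl fun y hy => ?_
    rw [boundaryField_eq_add hSR (hs y hy), boundaryField_congr J (ζ := ξ) _ y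
      (fun z hz => hζ z (by simpa using hz)), mul_add]
    congr 2
    exact Finset.sum_congr rfl fun x hx => by rw [hS x hx]
  rw [h1, h2]
  ring

/-- Schur's test: the arithmetic-geometric mean inequality splits each product into squares, and by
symmetry rows and columns of `|J|` have the same bound. -/
theorem abs_pairEnergy_le {J : V → V → ℝ} {M : ℝ} (hJ : ∀ x y, J x y = J y x) {S : Finset V}
    (hM : ∀ x, ∑ y ∈ S, |J x y| ≤ M) (Φ : V → ℝ) :
    |pairEnergy S J Φ| ≤ M / 2 * ∑ x ∈ S, Φ x ^ 2 := by
  unfold pairEnergy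
  have h1 : |∑ x ∈ S, ∑ y ∈ S, (if x = y then 0 else J x y * Φ x * Φ y)| ≤
      ∑ x ∈ S, ∑ y ∈ S, (|J x y| * Φ x ^ 2 / 2 + |J x y| * Φ y ^ 2 / 2) := by
    refine (Finset.abs_sum_le_sum_abs _ _).trans (Finset.sum_le_sum fun x _ => ?_)
    refine (Finset.abs_sum_le_sum_abs _ _).trans (Finset.sum_le_sum fun y _ => ?_)
    have hp : 0 ≤ |J x y| * Φ x ^ 2 / 2 + |J x y| * Φ y ^ 2 / 2 := by positivity
    split_ifs
    · simpa using hp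
    · rw [abs_mul, abs_mul, ← sq_abs (Φ x), ← sq_abs (Φ y)]
      nlinarith [mul_nonneg (abs_nonneg (J x y)) (sq_nonneg (|Φ x| - |Φ y|))]
  have h2 : ∑ x ∈ S, ∑ y ∈ S, |J x y| * Φ x ^ 2 / 2 ≤ M / 2 * ∑ x ∈ S, Φ x ^ 2 := by
    rw [Finset.mul_sum]
    refine Finset.sum_le_sum fun x _ => ?_
    rw [← Finset.sum_div, ← Finset.sum_mul]
    nlinarith [mul_le_mul_of_nonneg_right (hM x) (sq_nonneg (Φ x))]
  have h3 : ∑ x ∈ S, ∑ y ∈ S, |J x y| * Φ y ^ 2 / 2 ≤ M / 2 * ∑ x ∈ S, Φ x ^ 2 := by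
    rw [Finset.sum_comm, Finset.mul_sum]
    refine Finset.sum_le_sum fun x _ => ?_
    rw [← Finset.sum_div, ← Finset.sum_mul]
    simp only [hJ _ x]
    nlinarith [mul_le_mul_of_nonneg_right (hM x) (sq_nonneg (Φ x))]
  simp only [Finset.sum_add_distrib] at h1
  rw [abs_mul, abs_of_pos (by norm_num : (0 : ℝ) < 1 / 2)]
  linarith

end Hamiltonian

/-! ### Propagation and finiteness of the growth constants -/

section Growth

variable {V : Type u} {n δ M : ℝ} {J : V → V → ℝ} {f : ℝ → ℝ}

theorem IsAdmissible.weight_nonneg (h : IsAdmissible n J f δ M) (x y : V) :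
    0 ≤ |J x y| * f (J x y) :=
  mul_nonneg (abs_nonneg _) (zero_le_one.trans (h.one_le _))

theorem IsAdmissible.sum_weight_le (h : IsAdmissible n J f δ M) (x : V) (S : Finset V) :
    ∑ y ∈ S, |J x y| * f (J x y) ≤ M :=
  ((h.summable x).sum_le_tsum S fun _ _ => h.weight_nonneg x _).trans (h.tsum_le x)

theorem IsAdmissible.sum_abs_le (h : IsAdmissible n J f δ M) (x : V) (S : Finset V) :
    ∑ y ∈ S, |J x y| ≤ M :=
  (Finset.sum_le_sum fun _ _ => le_mul_of_one_le_right (abs_nonneg _) (h.one_le _)).trans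
    (h.sum_weight_le x S)

theorem IsAdmissible.tsum_compl_nonneg (h : IsAdmissible n J f δ M) (x : V) (R : Set V) :
    0 ≤ ∑' z : {z : V // z ∉ R}, |J x z| * f (J x z) :=
  tsum_nonneg fun z => h.weight_nonneg x z

theorem IsAdmissible.tsum_compl_le (h : IsAdmissible n J f δ M) (x : V) (R : Set V) :
    ∑' z : {z : V // z ∉ R}, |J x z| * f (J x z) ≤ M :=
  ((h.summable x).tsum_subtype_le _ Rᶜ (h.weight_nonneg x)).trans (h.tsum_le x)

theorem AdmitsBound.abs_boundaryField_le {ξ : V → ℝ} {C A : ℝ} {R : Set V} {x : V}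
    (hA : AdmitsBound n J f ξ C R x A) (h : IsAdmissible n J f δ M) (hC : 1 ≤ C) (hx : x ∈ R) :
    |boundaryField J ξ R x| ≤ M * C * A ^ (n - 1) := by
  have h1 := hA.2 x hx 0 (fun _ => x) ⟨rfl, rfl, by intro i _ hi; omega, by intro i hi; omega⟩
  simp only [zero_add, pow_one, Finset.range_zero, Finset.prod_empty, mul_one] at h1
  refine h1.trans ?_
  have hA0 : (0 : ℝ) ≤ A := zero_le_one.trans hA.1
  gcongr
  exact h.tsum_compl_le x R

theorem one_le_prod_rpow (h : IsAdmissible n J f δ M) (hn : 2 < n) (m : ℕ) (w : ℕ → V) :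
    1 ≤ ∏ i ∈ Finset.range m, f (J (w i) (w (i + 1))) ^ ((n - 1) ^ (m - i)) := by
  refine Finset.prod_induction _ (1 ≤ ·) (fun a b => one_le_mul_of_one_le_of_one_le) le_rfl
    fun i _ => ?_
  exact Real.one_le_rpow (h.one_le _) (pow_nonneg (by linarith) _)

theorem le_rpow_pow {A : ℝ} (hA : 1 ≤ A) (hn : 2 < n) (m : ℕ) : A ≤ A ^ ((n - 1) ^ m) :=
  Real.self_le_rpow_of_one_le hA (one_le_pow₀ (by linarith))

/-- Prepending `x` to a walk from `y` in `R` gives a walk from `x` in `S ∪ R` with one more step.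
The extra power `n - 1` of `A` and the factor from the edge `x y` are absorbed in the new constant.
The term `t / C` accounts for the sites of `S`, which have become boundary sites. -/
theorem AdmitsBound.of_adj [DecidableEq V] {ξ ζ : V → ℝ} {C A t : ℝ} {S R : Finset V} {x y : V}
    (h : IsAdmissible n J f δ M) (hn : 2 < n) (hC : 1 ≤ C) (hSR : Disjoint S R) (hx : x ∈ S)
    (hy : y ∈ R) (hxy : J x y ≠ 0) (hA : AdmitsBound n J f ξ C ((S ∪ R : Finset V) : Set V) x A)
    (hζ : ∀ z, z ∉ S ∪ R → ζ z = ξ z) (ht : ∀ z ∈ S, |ζ z| ≤ t)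
    (hs : ∀ y ∈ R, Summable fun z => J y z * ζ z) :
    AdmitsBound n J f ζ C (R : Set V) y ((A ^ (n - 1) + t / C) * f (J x y)) := by
  have hA1 : 1 ≤ A := hA.1
  have hC0 : 0 < C := by linarith
  have ht0 : 0 ≤ t := (abs_nonneg _).trans (ht x hx)
  have hAn : 1 ≤ A ^ (n - 1) := Real.one_le_rpow hA1 (by linarith)
  have htC : 0 ≤ t / C := by positivity
  set B := (A ^ (n - 1) + t / C) * f (J x y) with hB
  have hf := h.one_le (J x y)
  have hB1 : 1 ≤ B := by
    rw [hB]; exact one_le_mul_of_one_le_of_one_le (by linarith) hf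
  refine ⟨hB1, fun y' hy' m w hw => ?_⟩
  obtain ⟨hw0, hwm, hwi, hwJ⟩ := hw
  simp only [Set.mem_singleton_iff] at hw0 hwm
  have hwR : ∀ i, i ≤ m → w i ∈ R := by
    intro i hi
    rcases Nat.eq_zero_or_pos i with rfl | h0
    · rw [hw0]; exact hy
    rcases hi.eq_or_lt with rfl | h1
    · rw [hwm]; exact hy'
    · exact hwi i h0 h1
  have hwalk : IsWalk J ((S ∪ R : Finset V) : Set V) {x} {y'} (m + 1)
      (fun i => Nat.casesOn i x w) := by
    refine ⟨rfl, hwm, ?_, ?_⟩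
    · rintro (_ | i) h0 hi
      · omega
      · simpa using Or.inr (hwR i (by omega))
    · rintro (_ | i) hi
      · simpa [hw0] using hxy
      · exact hwJ i (by omega)
  have h1 := hA.2 y' (by simpa using Or.inr hy') (m + 1) _ hwalk
  rw [Finset.prod_range_succ'] at h1
  simp only [Nat.add_sub_add_right, Nat.sub_zero, hw0] at h1
  set P := ∏ i ∈ Finset.range m, f (J (w i) (w (i + 1))) ^ ((n - 1) ^ (m - i)) with hP
  have hP1 : 1 ≤ P := one_le_prod_rpow h hn m w
  -- The left side is `(A ^ (n - 1) * f (J x y)) ^ ((n - 1) ^ (m + 1))`.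
  have h2 : A ^ ((n - 1) ^ (m + 1 + 1)) * f (J x y) ^ ((n - 1) ^ (m + 1)) ≤
      B ^ ((n - 1) ^ (m + 1)) := by
    rw [pow_succ' (n - 1) (m + 1), Real.rpow_mul (by linarith),
      ← Real.mul_rpow (by linarith) (by linarith)]
    refine Real.rpow_le_rpow (mul_nonneg (by linarith) (by linarith)) ?_
      (pow_nonneg (by linarith) _)
    rw [hB]
    gcongr
    linarith
  have h3 : t ≤ C * B ^ ((n - 1) ^ (m + 1)) * P := by
    have h31 : t / C ≤ B := by
      rw [hB]
      exact (le_add_of_nonneg_left (by linarith)).trans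
        (le_mul_of_one_le_right (by linarith) hf)
    have h32 := h31.trans (le_rpow_pow hB1 hn (m + 1))
    rw [div_le_iff₀ hC0] at h32
    have h33 : 0 ≤ C * B ^ ((n - 1) ^ (m + 1)) := by positivity
    nlinarith
  set F := ∑' z : {z : V // z ∉ ((S ∪ R : Finset V) : Set V)}, |J y' z| * f (J y' z) with hF
  have hF0 : 0 ≤ F := h.tsum_compl_nonneg y' _
  have hFR : ∑' z : {z : V // z ∉ (R : Set V)}, |J y' z| * f (J y' z) =
      F + ∑ z ∈ S, |J y' z| * f (J y' z) := by
    have := boundaryField_eq_add (J := fun x y => |J x y| * f (J x y)) (ζ := fun _ => 1) (y := y')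
      hSR (by simpa using h.summable y')
    simpa [boundaryField, hF] using this
  rw [hFR, boundaryField_eq_add hSR (hs y' hy'), boundaryField_congr J (ζ := ξ) _ y'
    (fun z hz => hζ z (by simpa using hz))]
  have h4 : |boundaryField J ξ ((S ∪ R : Finset V) : Set V) y'| ≤
      F * (C * B ^ ((n - 1) ^ (m + 1)) * P) := by
    refine h1.trans ?_
    change F * C * A ^ ((n - 1) ^ (m + 1 + 1)) * (P * f (J x y) ^ ((n - 1) ^ (m + 1))) ≤ _
    have : F * C * A ^ ((n - 1) ^ (m + 1 + 1)) * (P * f (J x y) ^ ((n - 1) ^ (m + 1))) =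
      F * (C * (A ^ ((n - 1) ^ (m + 1 + 1)) * f (J x y) ^ ((n - 1) ^ (m + 1))) * P) := by ring
    rw [this]
    gcongr
  have h5 : |∑ z ∈ S, J y' z * ζ z| ≤
      (∑ z ∈ S, |J y' z| * f (J y' z)) * (C * B ^ ((n - 1) ^ (m + 1)) * P) := by
    refine (Finset.abs_sum_le_sum_abs _ _).trans ?_
    rw [Finset.sum_mul]
    refine Finset.sum_le_sum fun z hz => ?_
    rw [abs_mul]
    have h6 : |ζ z| ≤ C * B ^ ((n - 1) ^ (m + 1)) * P := (ht z hz).trans h3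
    have h7 := le_mul_of_one_le_right (abs_nonneg (J y' z)) (h.one_le (J y' z))
    exact mul_le_mul h7 h6 (abs_nonneg _) (h.weight_nonneg _ _)
  refine (abs_add_le _ _).trans ((add_le_add h4 h5).trans (le_of_eq ?_))
  ring

/-- Only finitely many fields occur, and the powers of `A` and `f` are at least their values without
exponent or at least `1`; so walks of every length are handled by one sum over `Λ`. -/
theorem exists_admitsBound (h : IsAdmissible n J f δ M) (hn : 2 < n) {C : ℝ} (hC : 1 ≤ C)
    (Λ : Finset V) (ξ : V → ℝ) (x : V) :
    ∃ A, AdmitsBound n J f ξ C (Λ : Set V) x A := by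
  set F : V → ℝ := fun y => ∑' z : {z : V // z ∉ (Λ : Set V)}, |J y z| * f (J y z) with hF
  have hF0 : ∀ y, 0 ≤ F y := fun y => h.tsum_compl_nonneg y _
  have hq : ∀ y, 0 ≤ |boundaryField J ξ (Λ : Set V) y| / F y := fun y =>
    div_nonneg (abs_nonneg _) (hF0 y)
  set A := 1 + ∑ y ∈ Λ, |boundaryField J ξ (Λ : Set V) y| / F y with hAdef
  have hA1 : 1 ≤ A := le_add_of_nonneg_right (Finset.sum_nonneg fun y _ => hq y)
  refine ⟨A, hA1, fun y hy m w _ => ?_⟩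
  have h1 : |boundaryField J ξ (Λ : Set V) y| ≤ F y * A := by
    -- If the total outside weight of `y` vanishes, then so do all its outside interactions and its
    -- field; the corresponding quotient in `A` is `0 / 0 = 0`.
    rcases (hF0 y).eq_or_lt with h0 | h0
    · have hz : ∀ z : {z : V // z ∉ (Λ : Set V)}, |J y z| * f (J y z) = 0 := by
        have hsum : Summable fun z : {z : V // z ∉ (Λ : Set V)} => |J y z| * f (J y z) :=
          (h.summable y).subtype _
        have hs0 := hsum.hasSum
        rw [show ∑' z : {z : V // z ∉ (Λ : Set V)}, |J y z| * f (J y z) = 0 from h0.symm] at hs0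
        exact fun z => congrFun ((hasSum_zero_iff_of_nonneg
          fun z : {z : V // z ∉ (Λ : Set V)} => h.weight_nonneg y z).1 hs0) z
      have hb : boundaryField J ξ (Λ : Set V) y = 0 := by
        unfold boundaryField
        convert tsum_zero with z
        have := hz z
        rw [mul_eq_zero, abs_eq_zero] at this
        rcases this with h' | h'
        · rw [h', zero_mul]
        · linarith [h.one_le (J y z)]
      rw [hb, ← h0]
      simp
    · rw [← div_le_iff₀' h0]
      exact (Finset.single_le_sum (fun y _ => hq y) hy).trans (by rw [hAdef]; linarith)
  have h2 := le_rpow_pow hA1 hn (m + 1)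
  have h3 := one_le_prod_rpow h hn m w
  set P := ∏ i ∈ Finset.range m, f (J (w i) (w (i + 1))) ^ ((n - 1) ^ (m - i))
  refine h1.trans ?_
  change F y * A ≤ F y * C * A ^ ((n - 1) ^ (m + 1)) * P
  have h4 : A ≤ C * A ^ ((n - 1) ^ (m + 1)) * P := by
    have h5 : 0 ≤ A ^ ((n - 1) ^ (m + 1)) := by positivity
    calc A ≤ A ^ ((n - 1) ^ (m + 1)) := h2
      _ ≤ C * A ^ ((n - 1) ^ (m + 1)) := le_mul_of_one_le_left h5 hC
      _ ≤ _ := le_mul_of_one_le_right (by positivity) h3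
  calc F y * A ≤ F y * (C * A ^ ((n - 1) ^ (m + 1)) * P) := by gcongr; exact hF0 y
    _ = _ := by ring

theorem isClosed_admitsBound (hn : 2 < n) (C : ℝ) (R : Set V) (ξ : V → ℝ) (x : V) :
    IsClosed {A | AdmitsBound n J f ξ C R x A} := by
  simp only [AdmitsBound, Set.ofPred_and, Set.ofPred_forall]
  refine (isClosed_le continuous_const continuous_id).inter ?_
  refine isClosed_iInter fun y => isClosed_iInter fun _ => isClosed_iInter fun m =>
    isClosed_iInter fun w => isClosed_iInter fun _ => ?_
  refine isClosed_le continuous_const (Continuous.mul (Continuous.mul continuous_const ?_)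
    continuous_const)
  exact Real.continuous_rpow_const (pow_nonneg (by linarith) _)

theorem boundaryGrowth_ne_top_and_admitsBound (h : IsAdmissible n J f δ M) (hn : 2 < n) {C : ℝ}
    (hC : 1 ≤ C) (Λ : Finset V) (ξ : V → ℝ) (x : V) :
    boundaryGrowth n J f ξ C (Λ : Set V) x ≠ ∞ ∧
      AdmitsBound n J f ξ C (Λ : Set V) x (boundaryGrowth n J f ξ C (Λ : Set V) x).toReal := by
  set T := {A | AdmitsBound n J f ξ C (Λ : Set V) x A} with hT
  have hbdd : BddBelow T := ⟨1, fun A hA => hA.1⟩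
  have hmem : sInf T ∈ T :=
    (isClosed_admitsBound hn C (Λ : Set V) ξ x).csInf_mem (exists_admitsBound h hn hC Λ ξ x) hbdd
  have heq : boundaryGrowth n J f ξ C (Λ : Set V) x = ENNReal.ofReal (sInf T) := by
    refine le_antisymm (iInf₂_le _ hmem) (le_iInf₂ fun A hA => ?_)
    exact ENNReal.ofReal_le_ofReal (csInf_le hbdd hA)
  rw [heq, ENNReal.toReal_ofReal (zero_le_one.trans hmem.1)]
  exact ⟨ENNReal.ofReal_ne_top, hmem⟩

end Growth

/-! ### Partition functions and their dependence on the boundary condition -/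

section PartitionFunction

variable {V : Type u} [DecidableEq V] {n a δ M : ℝ} {J : V → V → ℝ} {f : ℝ → ℝ}

/-- The unnormalised density of the Gibbs measure with respect to the product measure. -/
noncomputable def boltzmannWeight (Λ : Finset V) (β : ℝ) (J : V → V → ℝ) (ξ : V → ℝ)
    (φ : Λ → ℝ) : ℝ≥0∞ :=
  ENNReal.ofReal (Real.exp (-β * hamiltonian Λ J ξ φ))

theorem measurable_boltzmannWeight (Λ : Finset V) (β : ℝ) (J : V → V → ℝ) (ξ : V → ℝ) :
    Measurable (boltzmannWeight Λ β J ξ) :=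
  (Real.measurable_exp.comp ((measurable_hamiltonian Λ J ξ).const_mul _)).ennreal_ofReal

theorem partitionFunction_eq_lintegral {V : Type u} (Λ : Finset V) (β : ℝ) (ρ : Measure ℝ) (J : V → V → ℝ)
    (ξ : V → ℝ) :
    partitionFunction Λ β ρ J ξ = ∫⁻ φ, boltzmannWeight Λ β J ξ φ ∂(Measure.pi fun _ => ρ) :=
  rfl

theorem neg_mul_hamiltonian_le (h : IsAdmissible n J f δ M) (Λ : Finset V) {β : ℝ} (hβ : 0 ≤ β)
    (ξ Φ : V → ℝ) :
    -β * hamiltonian Λ J ξ (Λ.restrict Φ) ≤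
      ∑ x ∈ Λ, β * (M + ∑ y ∈ Λ, |boundaryField J ξ (Λ : Set V) y|) * (Φ x ^ 2 + |Φ x|) := by
  rw [hamiltonian_restrict, ← Finset.mul_sum]
  set c := ∑ y ∈ Λ, |boundaryField J ξ (Λ : Set V) y| with hc
  have hc0 : 0 ≤ c := Finset.sum_nonneg fun y _ => abs_nonneg _
  have h1 := (le_abs_self _).trans (abs_pairEnergy_le h.symm (fun x => h.sum_abs_le x Λ) Φ)
  have h2 : ∑ x ∈ Λ, Φ x * boundaryField J ξ (Λ : Set V) x ≤ ∑ x ∈ Λ, |Φ x| * c := by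
    refine Finset.sum_le_sum fun x hx => (le_abs_self _).trans ?_
    rw [abs_mul]
    gcongr
    exact Finset.single_le_sum (f := fun y => |boundaryField J ξ (Λ : Set V) y|)
      (fun y _ => abs_nonneg _) hx
  have h3 : ∑ x ∈ Λ, (Φ x ^ 2 + |Φ x|) = ∑ x ∈ Λ, Φ x ^ 2 + ∑ x ∈ Λ, |Φ x| :=
    Finset.sum_add_distrib
  have h4 : 0 ≤ ∑ x ∈ Λ, Φ x ^ 2 := Finset.sum_nonneg fun x _ => sq_nonneg _
  have h5 : 0 ≤ ∑ x ∈ Λ, |Φ x| := Finset.sum_nonneg fun x _ => abs_nonneg _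
  rw [← Finset.sum_mul] at h2
  have hM := h.M_pos
  have h6 : pairEnergy Λ J Φ + ∑ x ∈ Λ, Φ x * boundaryField J ξ (Λ : Set V) x ≤
      (M + c) * ∑ x ∈ Λ, (Φ x ^ 2 + |Φ x|) := by
    rw [h3]
    nlinarith [mul_nonneg hM.le h4, mul_nonneg hM.le h5, mul_nonneg hc0 h4]
  have := mul_le_mul_of_nonneg_left h6 hβ
  linarith

theorem partitionFunction_ne_top (h : IsAdmissible n J f δ M) (hn : 2 < n) (ha : 0 < a)
    (ρ : Measure ℝ) [SigmaFinite ρ]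
    (hρ : ∫⁻ u, ENNReal.ofReal (Real.exp (a * |u| ^ n)) ∂ρ < ∞) (Λ : Finset V) {β : ℝ}
    (hβ : 0 ≤ β) (ξ : V → ℝ) : partitionFunction Λ β ρ J ξ ≠ ∞ := by
  set c := β * (M + ∑ y ∈ Λ, |boundaryField J ξ (Λ : Set V) y|) with hc
  have hc0 : 0 ≤ c :=
    mul_nonneg hβ (add_nonneg h.M_pos.le (Finset.sum_nonneg fun y _ => abs_nonneg _))
  obtain ⟨k, hk⟩ := exists_quadratic_le_rpow hn ha c hc0
  have hle : partitionFunction Λ β ρ J ξ ≤ ∫⁻ φ : Λ → ℝ, ∏ x : Λ,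
      ENNReal.ofReal (Real.exp (a * |φ x| ^ n + k)) ∂(Measure.pi fun _ => ρ) := by
    refine lintegral_mono fun φ => ?_
    rw [← ENNReal.ofReal_prod_of_nonneg (fun x _ => (Real.exp_pos _).le), ← Real.exp_sum]
    refine ENNReal.ofReal_le_ofReal (Real.exp_le_exp.2 ?_)
    have h1 := neg_mul_hamiltonian_le h Λ hβ ξ (updateFinset ξ Λ φ)
    rw [restrict_updateFinset_self, ← Finset.sum_coe_sort Λ] at h1
    refine h1.trans (Finset.sum_le_sum fun x _ => ?_)
    simpa [updateFinset] using hk (φ x)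
  refine (hle.trans_lt ?_).ne
  have := lintegral_pi_prod ρ (fun (_ : Λ) u => ENNReal.ofReal (Real.exp (a * |u| ^ n + k)))
    (fun _ => by fun_prop)
  rw [this]
  refine ENNReal.prod_lt_top fun x _ => ?_
  simp only [Real.exp_add, ENNReal.ofReal_mul (Real.exp_pos _).le]
  rw [lintegral_mul_const' _ _ ENNReal.ofReal_ne_top]
  exact ENNReal.mul_lt_top hρ ENNReal.ofReal_lt_top

theorem partitionFunction_ne_zero (ρ : Measure ℝ) [SigmaFinite ρ] (hρ : ρ ≠ 0) (Λ : Finset V)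
    (β : ℝ) (J : V → V → ℝ) (ξ : V → ℝ) : partitionFunction Λ β ρ J ξ ≠ 0 := by
  rw [partitionFunction_eq_lintegral, Ne,
    lintegral_eq_zero_iff (measurable_boltzmannWeight Λ β J ξ)]
  intro h0
  have h1 : (Measure.pi fun _ : Λ => ρ) Set.univ = 0 := by
    convert ae_iff.1 h0
    ext φ
    simp [boltzmannWeight, Real.exp_pos]
  rw [Measure.pi_univ, Finset.prod_eq_zero_iff] at h1
  obtain ⟨_, _, h2⟩ := h1
  exact hρ (Measure.measure_univ_eq_zero.1 h2)

/-- Under the Gibbs measure on `R` with boundary condition `ζ`, the first absolute moment of each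
spin is at most `C` times any bound on the growth of the boundary condition seen from it. -/
def MomentBound (n : ℝ) (J : V → V → ℝ) (f : ℝ → ℝ) (ρ : Measure ℝ) (β C : ℝ) (R : Finset V)
    (ζ : V → ℝ) : Prop :=
  ∀ (y : R) (A : ℝ), AdmitsBound n J f ζ C (R : Set V) y A →
    ∫⁻ φ, ENNReal.ofReal |φ y| * boltzmannWeight R β J ζ φ ∂(Measure.pi fun _ => ρ) ≤
      ENNReal.ofReal (C * A) * partitionFunction R β ρ J ζ

/-- The energy difference between the two boundary conditions is at most `∑ d y * |φ y|`; apply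
Jensen under the unnormalised Gibbs measure for `ζ`. The numbers `m y` bound the means of the
summands. -/
theorem partitionFunction_le_of_moment (ρ : Measure ℝ) (R : Finset V) {β : ℝ} (hβ : 0 ≤ β)
    (J : V → V → ℝ) (ζ ζ' : V → ℝ) (m : R → ℝ) (hm : ∀ y, 0 ≤ m y)
    (hZ : partitionFunction R β ρ J ζ ≠ ∞)
    (hmom : ∀ y : R, ENNReal.ofReal
        |boundaryField J ζ' (R : Set V) y - boundaryField J ζ (R : Set V) y| *
        ∫⁻ φ, ENNReal.ofReal |φ y| * boltzmannWeight R β J ζ φ ∂(Measure.pi fun _ => ρ) ≤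
      ENNReal.ofReal (m y) * partitionFunction R β ρ J ζ) :
    partitionFunction R β ρ J ζ ≤
      ENNReal.ofReal (Real.exp (β * ∑ y, m y)) * partitionFunction R β ρ J ζ' := by
  set d : R → ℝ := fun y =>
    |boundaryField J ζ' (R : Set V) y - boundaryField J ζ (R : Set V) y| with hd
  set μ := (Measure.pi fun _ : R => ρ).withDensity (boltzmannWeight R β J ζ) with hμ
  have hμu : μ Set.univ = partitionFunction R β ρ J ζ := by
    rw [hμ, withDensity_apply _ MeasurableSet.univ, Measure.restrict_univ]
    rfl
  have hW := measurable_boltzmannWeight R β J ζ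
  set X : (R → ℝ) → ℝ := fun φ => β * ∑ y, d y * |φ y| with hX
  have hXm : Measurable X := by
    rw [hX]; fun_prop
  have hX0 : ∀ φ, 0 ≤ X φ := fun φ => mul_nonneg hβ
    (Finset.sum_nonneg fun y _ => mul_nonneg (abs_nonneg _) (abs_nonneg _))
  have hint : ∫⁻ φ, ENNReal.ofReal (X φ) ∂μ ≤
      ENNReal.ofReal (β * ∑ y, m y) * μ Set.univ := by
    have h1 : ∀ φ, ENNReal.ofReal (X φ) =
        ENNReal.ofReal β * ∑ y, ENNReal.ofReal (d y) * ENNReal.ofReal |φ y| := fun φ => by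
      rw [hX, ENNReal.ofReal_mul hβ, ENNReal.ofReal_sum_of_nonneg
        (fun y _ => mul_nonneg (abs_nonneg _) (abs_nonneg _))]
      simp only [hd, ENNReal.ofReal_mul (abs_nonneg _)]
    rw [ENNReal.ofReal_mul hβ, ENNReal.ofReal_sum_of_nonneg (fun y _ => hm y), mul_assoc,
      Finset.sum_mul, hμu]
    simp only [h1]
    rw [lintegral_const_mul _ (by fun_prop), lintegral_finsetSum _ (by fun_prop)]
    gcongr with y
    rw [lintegral_const_mul _ (by fun_prop), hμ, lintegral_withDensity_eq_lintegral_mul _ hW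
      (by fun_prop)]
    simpa only [Pi.mul_apply, mul_comm (boltzmannWeight R β J ζ _)] using hmom y
  have key := lintegral_exp_neg_ge μ X hXm hX0 (β * ∑ y, m y)
    (mul_nonneg hβ (Finset.sum_nonneg fun y _ => hm y)) (by rwa [hμu]) hint
  have h2 : ∫⁻ φ, ENNReal.ofReal (Real.exp (-X φ)) ∂μ ≤ partitionFunction R β ρ J ζ' := by
    rw [hμ, lintegral_withDensity_eq_lintegral_mul _ hW (by fun_prop)]
    refine lintegral_mono fun φ => ?_
    simp only [Pi.mul_apply, boltzmannWeight]
    rw [← ENNReal.ofReal_mul (Real.exp_pos _).le, ← Real.exp_add]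
    refine ENNReal.ofReal_le_ofReal (Real.exp_le_exp.2 ?_)
    have e1 := hamiltonian_restrict R J ζ (updateFinset ζ R φ)
    have e2 := hamiltonian_restrict R J ζ' (updateFinset ζ R φ)
    rw [restrict_updateFinset_self, ← Finset.sum_coe_sort R] at e1 e2
    have e3 : ∑ y : R, updateFinset ζ R φ y * boundaryField J ζ (R : Set V) y -
        ∑ y : R, d y * |φ y| ≤ ∑ y : R, updateFinset ζ R φ y * boundaryField J ζ' (R : Set V) y := by
      rw [← Finset.sum_sub_distrib]
      refine Finset.sum_le_sum fun y _ => ?_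
      have : updateFinset ζ R φ y = φ y := by simp [updateFinset]
      rw [this]
      have := neg_abs_le ((boundaryField J ζ' (R : Set V) y - boundaryField J ζ (R : Set V) y) * φ y)
      rw [abs_mul] at this
      simp only [hd]
      linarith
    have e4 := mul_le_mul_of_nonneg_left e3 hβ
    rw [e1, e2, hX]
    linarith
  rw [hμu] at key
  calc partitionFunction R β ρ J ζ
      = ENNReal.ofReal (Real.exp (β * ∑ y, m y)) *
        (ENNReal.ofReal (Real.exp (-(β * ∑ y, m y))) * partitionFunction R β ρ J ζ) := by
        rw [← mul_assoc, ← ENNReal.ofReal_mul (Real.exp_pos _).le, ← Real.exp_add]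
        simp
    _ ≤ _ := mul_le_mul_right (key.trans h2) _

/-- Only neighbours `y` of `i` feel the change. Their moment is at most `C * (A ^ (n - 1) + t / C) *
f (J i y)`, and weighting by `|J i y|` makes the sum over `y` at most `M * (C * A ^ (n - 1) + t)`.
-/
theorem partitionFunction_le_of_eqOn_ne (h : IsAdmissible n J f δ M) (hn : 2 < n) {ρ : Measure ℝ}
    {S R : Finset V} (hSR : Disjoint S R) {β C : ℝ} (hβ : 0 ≤ β) (hC : 1 ≤ C) {ξ ζ ζ' : V → ℝ}
    (hξ : ∀ z, z ∉ S ∪ R → ζ z = ξ z) {i : V} (hi : i ∈ S) (hζ : ∀ z, z ≠ i → ζ' z = ζ z) {t : ℝ}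
    (ht : ∀ z ∈ S, |ζ z| ≤ t) (hs : ∀ y ∈ R, Summable fun z => J y z * ζ z)
    (hs' : ∀ y ∈ R, Summable fun z => J y z * ζ' z)
    {A : ℝ} (hA : AdmitsBound n J f ξ C ((S ∪ R : Finset V) : Set V) i A)
    (hZ : partitionFunction R β ρ J ζ ≠ ∞) (hmom : MomentBound n J f ρ β C R ζ) :
    partitionFunction R β ρ J ζ ≤
      ENNReal.ofReal (Real.exp (β * (|ζ' i - ζ i| * (M * (C * A ^ (n - 1) + t))))) *
        partitionFunction R β ρ J ζ' := by
  have hiR : Disjoint {i} R := Finset.disjoint_singleton_left.2 (Finset.disjoint_left.1 hSR hi)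
  have hC0 : 0 < C := by linarith
  have hA1 := hA.1
  have ht0 : 0 ≤ t := (abs_nonneg _).trans (ht i hi)
  have hb : ∀ y ∈ R, boundaryField J ζ' (R : Set V) y - boundaryField J ζ (R : Set V) y =
      J i y * (ζ' i - ζ i) := fun y hy => by
    rw [boundaryField_eq_add hiR (hs y hy), boundaryField_eq_add hiR (hs' y hy),
      boundaryField_congr J (ξ := ζ') (ζ := ζ) _ y (fun z hz => hζ z (by rintro rfl; simp at hz)),
      h.symm i y]
    simp
    ring
  set q := C * A ^ (n - 1) + t with hq
  have hq0 : 0 ≤ q := by positivity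
  have key := partitionFunction_le_of_moment ρ R hβ J ζ ζ'
    (fun y => |ζ' i - ζ i| * (|J i y| * f (J i y) * q))
    (fun y => mul_nonneg (abs_nonneg _) (mul_nonneg (h.weight_nonneg _ _) hq0)) hZ ?_
  · refine key.trans ?_
    gcongr
    rw [← Finset.mul_sum, ← Finset.sum_mul, Finset.sum_coe_sort R (fun y => |J i y| * f (J i y))]
    gcongr
    exact h.sum_weight_le i R
  · intro y
    rw [hb y y.2, abs_mul]
    by_cases hJ : J i y = 0
    · simp [hJ]
    have h1 := hmom y _ (AdmitsBound.of_adj h hn hC hSR hi y.2 hJ hA hξ ht hs)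
    refine (mul_le_mul_right h1 _).trans (le_of_eq ?_)
    rw [← mul_assoc, ← ENNReal.ofReal_mul (by positivity)]
    congr 2
    rw [hq]
    field_simp

end PartitionFunction

/-! ### Densities of marginals and the inductive moment bound -/

section Marginal

variable {V : Type u} [DecidableEq V] {n a δ M : ℝ} {J : V → V → ℝ} {f : ℝ → ℝ}

theorem summable_of_eq_off {S : Finset V} {ξ ζ : V → ℝ} {y : V}
    (hξ : Summable fun z => |J y z * ξ z|) (hζ : ∀ z, z ∉ S → ζ z = ξ z) :
    Summable fun z => J y z * ζ z := by
  refine hξ.of_abs.congr_cofinite ?_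
  refine (Set.Finite.subset S.finite_toSet fun z hz => ?_)
  by_contra h
  exact hz (by simp [hζ z (by simpa using h)])

/-- The unnormalised density of the marginal on `S` of the Gibbs measure on `S ∪ R` with boundary
condition `ξ`, as a function of a configuration `ζ` extending `ξ`. -/
noncomputable def marginalWeight (S R : Finset V) (β : ℝ) (ρ : Measure ℝ) (J : V → V → ℝ)
    (ξ ζ : V → ℝ) : ℝ≥0∞ :=
  ENNReal.ofReal (Real.exp (β * (pairEnergy S J ζ +
    ∑ x ∈ S, ζ x * boundaryField J ξ ((S ∪ R : Finset V) : Set V) x))) *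
    partitionFunction R β ρ J ζ

theorem lintegral_restrict_mul_boltzmannWeight (hJ : ∀ x y, J x y = J y x) (ρ : Measure ℝ)
    [SigmaFinite ρ] {S R : Finset V} (hSR : Disjoint S R) (β : ℝ) {ξ : V → ℝ}
    (hs : ∀ y ∈ S ∪ R, Summable fun z => |J y z * ξ z|) {g : (S → ℝ) → ℝ≥0∞} (hg : Measurable g) :
    ∫⁻ φ : ↥(S ∪ R) → ℝ, g (Finset.restrict₂ (π := fun _ : V => ℝ) Finset.subset_union_left φ) *
        boltzmannWeight (S ∪ R) β J ξ φ ∂(Measure.pi fun _ => ρ) =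
      ∫⁻ ψ : S → ℝ, g ψ * marginalWeight S R β ρ J ξ (updateFinset ξ S ψ)
        ∂(Measure.pi fun _ => ρ) := by
  set F : (V → ℝ) → ℝ≥0∞ := fun Φ =>
    g (S.restrict Φ) * boltzmannWeight (S ∪ R) β J ξ ((S ∪ R).restrict Φ) with hF
  have hFm : Measurable F :=
    (hg.comp (Finset.measurable_restrict S)).mul
      ((measurable_boltzmannWeight _ _ _ _).comp (Finset.measurable_restrict (S ∪ R)))
  have h1 : ∀ φ : ↥(S ∪ R) → ℝ,
      g (Finset.restrict₂ (π := fun _ : V => ℝ) Finset.subset_union_left φ) *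
        boltzmannWeight (S ∪ R) β J ξ φ = F (updateFinset ξ (S ∪ R) φ) := fun φ => by
    rw [hF]
    simp only [restrict_updateFinset_self]
    rw [restrict_updateFinset_of_subset (π := fun _ : V => ℝ) Finset.subset_union_left]
  simp only [h1]
  have h2 := congrFun (lmarginal_union (fun _ : V => ρ) F hFm hSR) ξ
  rw [lmarginal] at h2
  rw [h2, lmarginal]
  refine lintegral_congr fun ψ => ?_
  rw [lmarginal, marginalWeight, partitionFunction_eq_lintegral, ← mul_assoc,
    ← lintegral_const_mul _ (measurable_boltzmannWeight _ _ _ _)]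
  refine lintegral_congr fun φ => ?_
  have hζ : ∀ z, z ∉ S → updateFinset ξ S ψ z = ξ z := fun z hz => by simp [updateFinset, hz]
  have h3 : S.restrict (updateFinset (updateFinset ξ S ψ) R φ) = ψ := by
    ext x
    simp [updateFinset, Finset.disjoint_left.1 hSR x.2]
  rw [hF]
  simp only [h3]
  rw [mul_assoc]
  congr 1
  unfold boltzmannWeight
  rw [← ENNReal.ofReal_mul (Real.exp_pos _).le, ← Real.exp_add,
    hamiltonian_union hJ hSR (ζ := updateFinset ξ S ψ)
      (fun z hz => hζ z fun h => hz (Finset.mem_union_left _ h))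
      (fun y hy => summable_of_eq_off (hs y (Finset.mem_union_right _ hy)) hζ)]
  congr 2
  ring

/-- The configuration equal to `ψ` on `T`, to `0` on `S \ T` and to `ξ` elsewhere. -/
def glue (S T : Finset V) (ψ ξ : V → ℝ) (v : V) : ℝ :=
  if v ∈ T then ψ v else if v ∈ S then 0 else ξ v

/-- Both directions are needed: one bounds the marginal density from above, the other bounds the
normalisation from below. -/
theorem partitionFunction_glue_comparison (h : IsAdmissible n J f δ M) (hn : 2 < n)
    {ρ : Measure ℝ} {S R : Finset V} (hSR : Disjoint S R) {β C : ℝ} (hβ : 0 ≤ β) (hC : 1 ≤ C)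
    {ξ : V → ℝ} (hs : ∀ y ∈ S ∪ R, Summable fun z => |J y z * ξ z|) {A : V → ℝ}
    (hA : ∀ x ∈ S, AdmitsBound n J f ξ C ((S ∪ R : Finset V) : Set V) x (A x))
    (hZ : ∀ ζ : V → ℝ, partitionFunction R β ρ J ζ ≠ ∞)
    (hmom : S.Nonempty → ∀ ζ : V → ℝ, (∀ z, z ∉ S → ζ z = ξ z) → MomentBound n J f ρ β C R ζ)
    (ψ : V → ℝ) (T : Finset V) (hT : T ⊆ S) :
    partitionFunction R β ρ J (glue S T ψ ξ) ≤
        ENNReal.ofReal (Real.exp (β * ∑ x ∈ T, |ψ x| * (M * (C * A x ^ (n - 1) + |ψ x|)))) *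
          partitionFunction R β ρ J (glue S ∅ ψ ξ) ∧
      partitionFunction R β ρ J (glue S ∅ ψ ξ) ≤
        ENNReal.ofReal (Real.exp (β * ∑ x ∈ T, |ψ x| * (M * (C * A x ^ (n - 1) + |ψ x|)))) *
          partitionFunction R β ρ J (glue S T ψ ξ) := by
  have hoff : ∀ U ⊆ S, ∀ z, z ∉ S → glue S U ψ ξ z = ξ z := fun U hU z hz => by
    have hzU : z ∉ U := fun h => hz (hU h)
    simp [glue, hz, hzU]
  have hsum : ∀ U ⊆ S, ∀ y ∈ R, Summable fun z => J y z * glue S U ψ ξ z := fun U hU y hy =>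
    summable_of_eq_off (hs y (Finset.mem_union_right _ hy)) (hoff U hU)
  -- The spin added last has the largest modulus, so `t = |ψ i|` bounds the configuration on `S`
  -- before and after the change, and the cost at `i` involves no other spin.
  induction T using Finset.induction_on_max_value (fun v => |ψ v|) with
  | empty => simp
  | insert i T hiT hmax ih =>
    obtain ⟨ih1, ih2⟩ := ih ((Finset.subset_insert i T).trans hT)
    have hTS := (Finset.subset_insert i T).trans hT
    have hi : i ∈ S := hT (Finset.mem_insert_self i T)
    have hne : ∀ z, z ≠ i → glue S (insert i T) ψ ξ z = glue S T ψ ξ z := fun z hz => by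
      simp [glue, hz]
    have hbd1 : ∀ z ∈ S, |glue S (insert i T) ψ ξ z| ≤ |ψ i| := fun z hz => by
      by_cases h1 : z = i
      · simp [glue, h1]
      · by_cases h2 : z ∈ T
        · simpa [glue, h2] using hmax z h2
        · simp [glue, h1, h2, hz]
    have hbd2 : ∀ z ∈ S, |glue S T ψ ξ z| ≤ |ψ i| := fun z hz => by
      by_cases h2 : z ∈ T
      · simpa [glue, h2] using hmax z h2
      · simp [glue, h2, hz]
    have hd : glue S T ψ ξ i = 0 := by simp [glue, hiT, hi]
    have hd' : glue S (insert i T) ψ ξ i = ψ i := by simp [glue]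
    have c1 := partitionFunction_le_of_eqOn_ne h hn hSR hβ hC
      (fun z hz => hoff _ hT z fun h => hz (Finset.mem_union_left _ h)) hi
      (fun z hz => (hne z hz).symm) hbd1 (hsum _ hT) (hsum _ hTS) (hA i hi) (hZ _)
      (hmom ⟨i, hi⟩ _ (hoff _ hT))
    have c2 := partitionFunction_le_of_eqOn_ne h hn hSR hβ hC
      (fun z hz => hoff _ hTS z fun h => hz (Finset.mem_union_left _ h)) hi
      hne hbd2 (hsum _ hTS) (hsum _ hT) (hA i hi) (hZ _)
      (hmom ⟨i, hi⟩ _ (hoff _ hTS))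
    rw [hd, hd', zero_sub, abs_neg] at c1
    rw [hd, hd', sub_zero] at c2
    rw [Finset.sum_insert hiT, mul_add, Real.exp_add, ENNReal.ofReal_mul (Real.exp_pos _).le]
    constructor
    · refine c1.trans ?_
      rw [mul_assoc]
      exact mul_le_mul_right ih1 _
    · refine ih2.trans ?_
      rw [mul_comm (ENNReal.ofReal _) (ENNReal.ofReal _), mul_assoc]
      exact mul_le_mul_right c2 _

/-- With `m = max (C * A) |u|`, both `C ^ (n - 2) * u ^ 2` and `C ^ (n - 2) * (C * A ^ (n - 1) *
|u|)` are at most `m ^ n`. Their coefficients are `3 / 2` and `2`, whose sum is at most `4`. -/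
theorem exponent_le {β C ε A u : ℝ} (hn : 2 < n) (hC : 1 ≤ C) (hA : 1 ≤ A) (hε : 0 ≤ ε)
    (hβ : β * M ≤ ε * C ^ (n - 2)) :
    β * (M / 2 * u ^ 2 + |u| * (M * C * A ^ (n - 1)) + |u| * (M * (C * A ^ (n - 1) + |u|))) ≤
      4 * ε * ((C * A) ^ n + |u| ^ n) := by
  set t := |u| with ht
  have ht0 : 0 ≤ t := abs_nonneg u
  have hC0 : 0 < C := by linarith
  have hA0 : 0 < A := by linarith
  rw [← sq_abs, ← ht]
  set m := max (C * A) t with hm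
  have hm0 : 0 < m := lt_max_of_lt_left (by positivity)
  have h1 : C ^ (n - 2) * t ^ 2 ≤ m ^ n := by
    have e : m ^ n = m ^ (n - 2) * m ^ 2 := by
      rw [← Real.rpow_natCast, ← Real.rpow_add hm0]; norm_num
    rw [e]
    have : C ≤ m := (le_mul_of_one_le_right hC0.le hA).trans (le_max_left _ _)
    have h2 : t ≤ m := le_max_right _ _
    have h3 : 0 ≤ n - 2 := by linarith
    gcongr
  have h2 : C ^ (n - 2) * (C * A ^ (n - 1) * t) ≤ m ^ n := by
    have e : m ^ n = m ^ (n - 1) * m := by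
      rw [← Real.rpow_add_one hm0.ne']; norm_num
    have e2 : C ^ (n - 2) * (C * A ^ (n - 1) * t) = (C * A) ^ (n - 1) * t := by
      rw [Real.mul_rpow hC0.le hA0.le, show n - 1 = n - 2 + 1 by ring, Real.rpow_add_one hC0.ne']
      ring
    rw [e, e2]
    have : C * A ≤ m := le_max_left _ _
    have h2 : t ≤ m := le_max_right _ _
    have h3 : 0 ≤ n - 1 := by linarith
    gcongr
  have h3 : m ^ n ≤ (C * A) ^ n + t ^ n := by
    have p1 : 0 ≤ (C * A) ^ n := by positivity
    have p2 : 0 ≤ t ^ n := by positivity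
    rcases max_choice (C * A) t with h | h <;> rw [hm, h] <;> linarith
  have h4 : 0 ≤ 3 / 2 * t ^ 2 + 2 * (C * A ^ (n - 1) * t) := by positivity
  have h5 := mul_le_mul_of_nonneg_right hβ h4
  have h6 : 0 ≤ m ^ n := by positivity
  have h7 := mul_le_mul_of_nonneg_left h1 hε
  have h8 := mul_le_mul_of_nonneg_left h2 hε
  have h9 := mul_le_mul_of_nonneg_left h3 hε
  nlinarith [mul_nonneg hε h6]

theorem marginalWeight_comparison (h : IsAdmissible n J f δ M) (hn : 2 < n)
    {ρ : Measure ℝ} {S R : Finset V} (hSR : Disjoint S R) {β C ε : ℝ} (hβ : 0 ≤ β) (hC : 1 ≤ C)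
    (hε : 0 ≤ ε) (hβM : β * M ≤ ε * C ^ (n - 2))
    {ξ : V → ℝ} (hs : ∀ y ∈ S ∪ R, Summable fun z => |J y z * ξ z|) {A : V → ℝ}
    (hA : ∀ x ∈ S, AdmitsBound n J f ξ C ((S ∪ R : Finset V) : Set V) x (A x))
    (hZ : ∀ ζ : V → ℝ, partitionFunction R β ρ J ζ ≠ ∞)
    (hmom : S.Nonempty → ∀ ζ : V → ℝ, (∀ z, z ∉ S → ζ z = ξ z) → MomentBound n J f ρ β C R ζ)
    (ψ : S → ℝ) :
    marginalWeight S R β ρ J ξ (updateFinset ξ S ψ) ≤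
        (∏ x : S, ENNReal.ofReal (Real.exp (4 * ε * ((C * A x) ^ n + |ψ x| ^ n)))) *
          partitionFunction R β ρ J (glue S ∅ 0 ξ) ∧
      partitionFunction R β ρ J (glue S ∅ 0 ξ) ≤
        (∏ x : S, ENNReal.ofReal (Real.exp (4 * ε * ((C * A x) ^ n + |ψ x| ^ n)))) *
          marginalWeight S R β ρ J ξ (updateFinset ξ S ψ) := by
  set ζ := updateFinset ξ S ψ with hζ
  have hζx : ∀ x : S, ζ x = ψ x := fun x => by simp [hζ, updateFinset]
  have hglue : glue S S ζ ξ = ζ := by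
    funext v
    by_cases hv : v ∈ S <;> simp [glue, hζ, updateFinset, hv]
  have hglue0 : glue S ∅ ζ ξ = glue S ∅ 0 ξ := by
    funext v
    simp [glue]
  obtain ⟨c1, c2⟩ := partitionFunction_glue_comparison h hn hSR hβ hC hs hA hZ hmom ζ S subset_rfl
  rw [hglue, hglue0] at c1 c2
  set q := pairEnergy S J ζ +
    ∑ x ∈ S, ζ x * boundaryField J ξ ((S ∪ R : Finset V) : Set V) x with hq
  have hqle : |q| ≤ ∑ x ∈ S, (M / 2 * ζ x ^ 2 + |ζ x| * (M * C * A x ^ (n - 1))) := by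
    rw [Finset.sum_add_distrib, ← Finset.mul_sum]
    refine (abs_add_le _ _).trans (add_le_add
      (abs_pairEnergy_le h.symm (fun x => h.sum_abs_le x S) ζ) ?_)
    refine (Finset.abs_sum_le_sum_abs _ _).trans (Finset.sum_le_sum fun x hx => ?_)
    rw [abs_mul]
    gcongr
    exact (hA x hx).abs_boundaryField_le h hC (by simp [hx])
  have hexp : β * |q| + β * ∑ x ∈ S, |ζ x| * (M * (C * A x ^ (n - 1) + |ζ x|)) ≤
      ∑ x : S, 4 * ε * ((C * A x) ^ n + |ψ x| ^ n) := by
    have e1 := mul_le_mul_of_nonneg_left hqle hβ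
    refine (add_le_add_left e1 _).trans ?_
    rw [← mul_add, ← Finset.sum_add_distrib, Finset.mul_sum, ← Finset.sum_coe_sort S]
    refine Finset.sum_le_sum fun x _ => ?_
    rw [hζx x]
    exact exponent_le hn hC (hA x x.2).1 hε hβM
  rw [← ENNReal.ofReal_prod_of_nonneg (fun x _ => (Real.exp_pos _).le), ← Real.exp_sum]
  unfold marginalWeight
  rw [← hq]
  constructor
  · refine (mul_le_mul_right c1 _).trans ?_
    rw [← mul_assoc, ← ENNReal.ofReal_mul (Real.exp_pos _).le, ← Real.exp_add]
    gcongr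
    exact (add_le_add_left (mul_le_mul_of_nonneg_left (le_abs_self q) hβ) _).trans hexp
  · refine c2.trans ?_
    rw [← mul_assoc, ← ENNReal.ofReal_mul (Real.exp_pos _).le, ← Real.exp_add]
    gcongr
    have := mul_le_mul_of_nonneg_left (neg_abs_le q) hβ
    linarith

theorem lintegral_marginal_le (h : IsAdmissible n J f δ M) (hn : 2 < n)
    {ρ : Measure ℝ} [IsFiniteMeasure ρ] {S R : Finset V} (hSR : Disjoint S R) {β C ε L : ℝ}
    (hβ : 0 ≤ β) (hC : 1 ≤ C) (hε : 0 ≤ ε) (hβM : β * M ≤ ε * C ^ (n - 2)) (hLC : L ≤ C)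
    (hp : ρ (Set.Icc (-L) L) ≠ 0)
    {ξ : V → ℝ} (hs : ∀ y ∈ S ∪ R, Summable fun z => |J y z * ξ z|) {A : V → ℝ}
    (hA : ∀ x ∈ S, AdmitsBound n J f ξ C ((S ∪ R : Finset V) : Set V) x (A x))
    (hZ : ∀ ζ : V → ℝ, partitionFunction R β ρ J ζ ≠ ∞)
    (hmom : S.Nonempty → ∀ ζ : V → ℝ, (∀ z, z ∉ S → ζ z = ξ z) → MomentBound n J f ρ β C R ζ)
    {g : (S → ℝ) → ℝ≥0∞} (hg : Measurable g) :
    ∫⁻ φ : ↥(S ∪ R) → ℝ, g (Finset.restrict₂ (π := fun _ : V => ℝ) Finset.subset_union_left φ) *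
        boltzmannWeight (S ∪ R) β J ξ φ ∂(Measure.pi fun _ => ρ) ≤
      (∫⁻ ψ : S → ℝ, g ψ * ∏ x : S, ((ρ (Set.Icc (-L) L))⁻¹ *
        ENNReal.ofReal (Real.exp (12 * ε * (C * A x) ^ n + 4 * ε * |ψ x| ^ n)))
          ∂(Measure.pi fun _ => ρ)) * partitionFunction (S ∪ R) β ρ J ξ := by
  set p := ρ (Set.Icc (-L) L) with hpdef
  have hp' : p ≠ ∞ := measure_ne_top _ _
  set Z₀ := partitionFunction R β ρ J (glue S ∅ 0 ξ) with hZ₀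
  have hcmp := marginalWeight_comparison h hn hSR hβ hC hε hβM hs hA hZ hmom
  have hE : ∀ x ∈ S, C ≤ C * A x := fun x hx =>
    le_mul_of_one_le_right (by linarith) (hA x hx).1
  -- Keep only configurations with all spins of `S` in `[-L, L]`. There `|ψ x| ≤ L ≤ C ≤ C * A x`,
  -- so the exponent `4 + 4` gives `8`; the upper bound for the density adds another `4`, whence
  -- `12`.
  have hlower : (∏ _x : S, p) * Z₀ ≤
      (∏ x : S, ENNReal.ofReal (Real.exp (8 * ε * (C * A x) ^ n))) *
        partitionFunction (S ∪ R) β ρ J ξ := by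
    have e1 := lintegral_restrict_mul_boltzmannWeight h.symm ρ hSR β hs
      (g := fun _ => 1) measurable_const
    simp only [one_mul] at e1
    rw [partitionFunction_eq_lintegral, e1]
    have e2 := lintegral_pi_prod ρ (fun _ : S => (Set.Icc (-L) L).indicator fun _ => 1)
      (fun _ => measurable_const.indicator measurableSet_Icc)
    simp only [lintegral_indicator_const measurableSet_Icc, one_mul] at e2
    rw [← hpdef] at e2
    rw [← e2, ← lintegral_mul_const' _ _ (hZ _),
      ← lintegral_const_mul' _ _ (ENNReal.prod_ne_top fun _ _ => ENNReal.ofReal_ne_top)]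
    refine lintegral_mono fun ψ => ?_
    by_cases hψ : ∀ x : S, ψ x ∈ Set.Icc (-L) L
    · simp only [Set.indicator_of_mem (hψ _), Finset.prod_const_one, one_mul]
      refine (hcmp ψ).2.trans ?_
      refine mul_le_mul_left (Finset.prod_le_prod' fun x _ =>
        ENNReal.ofReal_le_ofReal (Real.exp_le_exp.2 ?_)) _
      have h1 : |ψ x| ≤ C * A x := (abs_le.2 (hψ x)).trans (hLC.trans (hE x x.2))
      have h2 : |ψ x| ^ n ≤ (C * A x) ^ n :=
        Real.rpow_le_rpow (abs_nonneg _) h1 (by linarith)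
      nlinarith
    · push Not at hψ
      obtain ⟨x, hx⟩ := hψ
      rw [Finset.prod_eq_zero (Finset.mem_univ x) (Set.indicator_of_notMem hx _), zero_mul]
      exact zero_le
  have hP : ∀ ψ : S → ℝ, (∏ x : S, ENNReal.ofReal (Real.exp (4 * ε * ((C * A x) ^ n + |ψ x| ^ n)))) *
      Z₀ ≤ (∏ x : S, (p⁻¹ * ENNReal.ofReal
        (Real.exp (12 * ε * (C * A x) ^ n + 4 * ε * |ψ x| ^ n)))) *
          partitionFunction (S ∪ R) β ρ J ξ := fun ψ => by
    have e1 : Z₀ = (∏ _x : S, p⁻¹) * ((∏ _x : S, p) * Z₀) := by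
      rw [← mul_assoc, ← Finset.prod_mul_distrib]
      simp [ENNReal.inv_mul_cancel hp hp']
    rw [e1]
    refine (mul_le_mul_right (mul_le_mul_right hlower _) _).trans (le_of_eq ?_)
    simp only [← mul_assoc, ← Finset.prod_mul_distrib]
    congr 1
    refine Finset.prod_congr rfl fun x _ => ?_
    rw [mul_comm _ p⁻¹, mul_assoc, ← ENNReal.ofReal_mul (Real.exp_pos _).le, ← Real.exp_add]
    congr 3
    ring
  have hm : Measurable fun ψ : S → ℝ => g ψ * ∏ x : S, (p⁻¹ *
      ENNReal.ofReal (Real.exp (12 * ε * (C * A x) ^ n + 4 * ε * |ψ x| ^ n))) :=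
    hg.mul (Finset.measurable_fun_prod _ fun x _ => Measurable.const_mul (by fun_prop) _)
  rw [lintegral_restrict_mul_boltzmannWeight h.symm ρ hSR β hs hg, ← lintegral_mul_const _ hm]
  refine lintegral_mono fun ψ => ?_
  simp only
  rw [mul_assoc]
  exact mul_le_mul_right (((hcmp ψ).1).trans (hP ψ)) _

/-- Induction on the number of sites: the marginal at `y` is controlled by moments in the region
without `y`, for every value of the spin at `y`. -/
theorem momentBound (h : IsAdmissible n J f δ M) (hn : 2 < n) (ha : 0 < a)
    {ρ : Measure ℝ} [IsFiniteMeasure ρ]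
    (hρ : ∫⁻ u, ENNReal.ofReal (Real.exp (a * |u| ^ n)) ∂ρ < ∞) {β C ε L : ℝ}
    (hβ : 0 ≤ β) (hC : 1 ≤ C) (hε : 0 ≤ ε) (hβM : β * M ≤ ε * C ^ (n - 2)) (hLC : L ≤ C)
    (hp : ρ (Set.Icc (-L) L) ≠ 0) (hεa : (4 + 12 * 2 ^ n) * ε ≤ a / 2)
    (hB : (ρ (Set.Icc (-L) L))⁻¹ *
      ∫⁻ u, ENNReal.ofReal (|u| * Real.exp (a / 2 * |u| ^ n)) ∂ρ ≤ ENNReal.ofReal (C / 2))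
    (Λ : Finset V) (ξ : V → ℝ) (hs : ∀ y ∈ Λ, Summable fun z => |J y z * ξ z|) :
    MomentBound n J f ρ β C Λ ξ := by
  induction hk : Λ.card using Nat.strong_induction_on generalizing Λ ξ with
  | _ k ih =>
  rintro ⟨y, hy⟩ A hA
  obtain ⟨R, hyR, rfl⟩ : ∃ R, Disjoint {y} R ∧ Λ = {y} ∪ R :=
    ⟨Λ.erase y, by simp, by rw [← Finset.insert_eq, Finset.insert_erase hy]⟩
  have hA1 : 1 ≤ A := by
    exact hA.1
  set E := C * A with hE
  have hEC : C ≤ E := le_mul_of_one_le_right (by linarith) hA1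
  set p := ρ (Set.Icc (-L) L) with hpdef
  have hsub : ∀ ζ : V → ℝ, (∀ z, z ∉ ({y} : Finset V) → ζ z = ξ z) →
      MomentBound n J f ρ β C R ζ := fun ζ hζ => by
    refine ih R.card ?_ R ζ (fun z hz =>
      (summable_of_eq_off (hs z (Finset.mem_union_right _ hz)) hζ).abs) rfl
    rw [← hk, Finset.card_union_of_disjoint hyR]
    simp
  set tail : ℝ → ℝ≥0∞ := {u | E / 2 < |u|}.indicator fun u => ENNReal.ofReal |u| with htail
  have htm : Measurable tail := by
    refine Measurable.indicator (by fun_prop) (measurableSet_lt measurable_const (by fun_prop))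
  have key := lintegral_marginal_le h hn hyR hβ hC hε hβM hLC hp hs (A := fun _ => A)
    (fun x hx => by rw [Finset.mem_singleton.1 hx]; exact hA)
    (fun ζ => partitionFunction_ne_top h hn ha ρ hρ R hβ ζ) (fun _ => hsub)
    (g := fun ψ => tail (ψ ⟨y, Finset.mem_singleton_self y⟩))
    (htm.comp (measurable_pi_apply _))
  have hI : ∫⁻ ψ : ({y} : Finset V) → ℝ, tail (ψ ⟨y, Finset.mem_singleton_self y⟩) *
      ∏ x : ({y} : Finset V), (p⁻¹ * ENNReal.ofReal
        (Real.exp (12 * ε * (C * A) ^ n + 4 * ε * |ψ x| ^ n))) ∂(Measure.pi fun _ => ρ) ≤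
      ENNReal.ofReal (E / 2) := by
    have e1 := lintegral_pi_prod ρ (fun (_ : ({y} : Finset V)) u => tail u * (p⁻¹ * ENNReal.ofReal
        (Real.exp (12 * ε * (C * A) ^ n + 4 * ε * |u| ^ n))))
        (fun _ => htm.mul (Measurable.const_mul (by fun_prop) _))
    simp only [Finset.univ_unique, Finset.prod_singleton] at e1
    simp only [Finset.univ_unique, Finset.prod_singleton]
    refine (le_of_eq e1).trans ?_
    refine le_trans ?_ (hB.trans (ENNReal.ofReal_le_ofReal (by linarith)))
    rw [← lintegral_const_mul _ (by fun_prop)]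
    refine lintegral_mono fun u => ?_
    by_cases hu : E / 2 < |u|
    · simp only [htail]
      rw [Set.indicator_of_mem (show u ∈ {u | E / 2 < |u|} from hu), mul_left_comm,
        ← ENNReal.ofReal_mul (abs_nonneg _)]
      gcongr
      -- On the tail, `12 * ε * E ^ n + 4 * ε * |u| ^ n` is at most `(4 + 12 * 2 ^ n) * ε * |u| ^
      -- n`, which is where the condition on `ε` comes from.
      have h1 : E ^ n ≤ 2 ^ n * |u| ^ n := by
        rw [← Real.mul_rpow (by norm_num) (abs_nonneg _)]
        exact Real.rpow_le_rpow (by linarith) (by linarith) (by linarith)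
      have h2 : 0 ≤ |u| ^ n := by positivity
      nlinarith [mul_le_mul_of_nonneg_right hεa h2, mul_le_mul_of_nonneg_left h1 hε]
    · simp only [htail]
      rw [Set.indicator_of_notMem (show u ∉ {u | E / 2 < |u|} from hu), zero_mul]
      exact zero_le
  have hW := measurable_boltzmannWeight ({y} ∪ R) β J ξ
  calc ∫⁻ φ, ENNReal.ofReal |φ ⟨y, hy⟩| * boltzmannWeight ({y} ∪ R) β J ξ φ
        ∂(Measure.pi fun _ => ρ)
      ≤ ∫⁻ φ, (ENNReal.ofReal (E / 2) * boltzmannWeight ({y} ∪ R) β J ξ φ +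
          tail (φ ⟨y, hy⟩) * boltzmannWeight ({y} ∪ R) β J ξ φ) ∂(Measure.pi fun _ => ρ) := by
        refine lintegral_mono fun φ => ?_
        simp only
        rw [← add_mul]
        gcongr
        by_cases hu : E / 2 < |φ ⟨y, hy⟩|
        · simp only [htail]
          rw [Set.indicator_of_mem (show φ ⟨y, hy⟩ ∈ {u | E / 2 < |u|} from hu)]
          exact le_add_self
        · exact (ENNReal.ofReal_le_ofReal (not_lt.1 hu)).trans le_self_add
    _ ≤ ENNReal.ofReal (E / 2) * partitionFunction ({y} ∪ R) β ρ J ξ +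
          ENNReal.ofReal (E / 2) * partitionFunction ({y} ∪ R) β ρ J ξ := by
        rw [lintegral_add_left (hW.const_mul _), lintegral_const_mul _ hW]
        refine add_le_add le_rfl (key.trans ?_)
        gcongr
    _ = ENNReal.ofReal E * partitionFunction ({y} ∪ R) β ρ J ξ := by
        rw [← add_mul, ← ENNReal.ofReal_add (by linarith) (by linarith)]
        congr 2
        ring

end Marginal

/-! ### From densities to probability measures -/

section Normalisation

theorem gibbs_free_apply {V : Type u} [DecidableEq V] (S : Finset V) (ρ : Measure ℝ)
    [IsFiniteMeasure ρ] (b n : ℝ) (hfin : ∫⁻ u, ENNReal.ofReal (Real.exp (b * |u| ^ n)) ∂ρ ≠ ∞)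
    {s : Set (S → ℝ)} (hs : MeasurableSet s) :
    gibbs S 0 (tilt ρ b n) (fun _ _ => 0) (fun _ => 0) s =
      (∏ _x : S, ∫⁻ u, ENNReal.ofReal (Real.exp (b * |u| ^ n)) ∂ρ)⁻¹ *
        ∫⁻ ψ in s, ∏ x : S, ENNReal.ofReal (Real.exp (b * |ψ x| ^ n))
          ∂(Measure.pi fun _ => ρ) := by
  have : IsFiniteMeasure (ρ.withDensity fun u => ENNReal.ofReal (Real.exp (b * |u| ^ n))) :=
    isFiniteMeasure_withDensity hfin
  have hpi := pi_withDensity (ι := S) ρ (fun u => ENNReal.ofReal (Real.exp (b * |u| ^ n)))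
    (by fun_prop)
  unfold gibbs partitionFunction tilt
  simp only [neg_zero, zero_mul, Real.exp_zero, ENNReal.ofReal_one, lintegral_one]
  rw [Measure.pi_univ]
  simp only [withDensity_apply _ MeasurableSet.univ, Measure.restrict_univ]
  rw [Measure.smul_apply, smul_eq_mul, withDensity_apply _ hs, setLIntegral_one, hpi,
    withDensity_apply _ hs]

theorem isProbabilityMeasure_gibbs {V : Type u} (Λ : Finset V) (β : ℝ) (ρ : Measure ℝ)
    (J : V → V → ℝ) (ξ : V → ℝ) (h0 : partitionFunction Λ β ρ J ξ ≠ 0)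
    (h1 : partitionFunction Λ β ρ J ξ ≠ ∞) : IsProbabilityMeasure (gibbs Λ β ρ J ξ) := by
  refine ⟨?_⟩
  unfold gibbs
  rw [Measure.smul_apply, smul_eq_mul, withDensity_apply _ MeasurableSet.univ,
    Measure.restrict_univ]
  exact ENNReal.inv_mul_cancel h0 h1

theorem gibbs_map_restrict_apply {V : Type u} [DecidableEq V] (S R : Finset V) (β : ℝ)
    (ρ : Measure ℝ) (J : V → V → ℝ) (ξ : V → ℝ) (hS : S ⊆ S ∪ R) {s : Set (S → ℝ)}
    (hs : MeasurableSet s) :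
    (gibbs (S ∪ R) β ρ J ξ).map (Finset.restrict₂ (π := fun _ : V => ℝ) hS) s =
      (partitionFunction (S ∪ R) β ρ J ξ)⁻¹ *
        ∫⁻ φ, s.indicator 1 (Finset.restrict₂ (π := fun _ : V => ℝ) hS φ) *
          boltzmannWeight (S ∪ R) β J ξ φ ∂(Measure.pi fun _ => ρ) := by
  have hm : Measurable (Finset.restrict₂ (π := fun _ : V => ℝ) hS) :=
    Finset.measurable_restrict₂ hS
  rw [Measure.map_apply hm hs]
  unfold gibbs
  rw [Measure.smul_apply, smul_eq_mul, withDensity_apply _ (hm hs),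
    ← lintegral_indicator (hm hs)]
  congr 1
  refine lintegral_congr fun φ => ?_
  by_cases h : Finset.restrict₂ (π := fun _ : V => ℝ) hS φ ∈ s
  · rw [Set.indicator_of_mem (show φ ∈ _ ⁻¹' s from h), Set.indicator_of_mem h]
    simp [boltzmannWeight]
  · rw [Set.indicator_of_notMem (show φ ∉ _ ⁻¹' s from h), Set.indicator_of_notMem h, zero_mul]

theorem add_rpow_le_two_rpow_mul {n x y : ℝ} (hn : 0 ≤ n) (hx : 0 ≤ x) (hy : 0 ≤ y) :
    (x + y) ^ n ≤ 2 ^ n * (x ^ n + y ^ n) := by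
  have h1 : (x + y) ^ n ≤ (2 * max x y) ^ n := Real.rpow_le_rpow (by positivity)
    (by linarith [le_max_left x y, le_max_right x y]) hn
  rw [Real.mul_rpow (by norm_num) (le_max_of_le_left hx)] at h1
  refine h1.trans ?_
  have p1 : 0 ≤ x ^ n := by positivity
  have p2 : 0 ≤ y ^ n := by positivity
  gcongr
  rcases max_choice x y with h | h <;> rw [h] <;> linarith

theorem exists_Icc_measure_ne_zero {ρ : Measure ℝ} (hρ : ρ ≠ 0) :
    ∃ k : ℕ, ρ (Set.Icc (-(k : ℝ)) k) ≠ 0 := by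
  by_contra! h
  refine hρ (Measure.measure_univ_eq_zero.1 ?_)
  have : (Set.univ : Set ℝ) = ⋃ k : ℕ, Set.Icc (-(k : ℝ)) k := by
    symm
    rw [Set.eq_univ_iff_forall]
    intro u
    obtain ⟨k, hk⟩ := exists_nat_ge |u|
    exact Set.mem_iUnion.2 ⟨k, abs_le.1 hk⟩
  rw [this]
  exact measure_iUnion_null h

theorem gibbs_map_restrict_le {V : Type u} [DecidableEq V] {n a δ M : ℝ} {J : V → V → ℝ}
    {f : ℝ → ℝ} (h : IsAdmissible n J f δ M) (hn : 2 < n) (ha : 0 < a)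
    {ρ : Measure ℝ} [IsFiniteMeasure ρ] (hρ0 : ρ ≠ 0)
    (hρ : ∫⁻ u, ENNReal.ofReal (Real.exp (a * |u| ^ n)) ∂ρ < ∞) {S R : Finset V}
    (hSR : Disjoint S R) {β C ε L D : ℝ}
    (hβ : 0 ≤ β) (hC : 1 ≤ C) (hε : 0 ≤ ε) (hβM : β * M ≤ ε * C ^ (n - 2)) (hLC : L ≤ C)
    (hp : ρ (Set.Icc (-L) L) ≠ 0) (hεa : (4 + 12 * 2 ^ n) * ε ≤ a / 2)
    (hB : (ρ (Set.Icc (-L) L))⁻¹ *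
      ∫⁻ u, ENNReal.ofReal (|u| * Real.exp (a / 2 * |u| ^ n)) ∂ρ ≤ ENNReal.ofReal (C / 2))
    (hN0 : ∫⁻ u, ENNReal.ofReal (Real.exp (a / 2 * |u| ^ n)) ∂ρ ≠ 0)
    (hN : ∫⁻ u, ENNReal.ofReal (Real.exp (a / 2 * |u| ^ n)) ∂ρ ≠ ∞)
    (hD : 12 * ε * C ^ n + ((ρ (Set.Icc (-L) L))⁻¹ *
      ∫⁻ u, ENNReal.ofReal (Real.exp (a / 2 * |u| ^ n)) ∂ρ).toReal ≤ D)
    {ξ : V → ℝ} (hs : ∀ y ∈ S ∪ R, Summable fun z => |J y z * ξ z|) {A : V → ℝ}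
    (hA : ∀ x ∈ S, AdmitsBound n J f ξ C ((S ∪ R : Finset V) : Set V) x (A x)) (hS : S ⊆ S ∪ R) :
    (gibbs (S ∪ R) β ρ J ξ).map (Finset.restrict₂ (π := fun _ : V => ℝ) hS) ≤
      (∏ x ∈ S, ENNReal.ofReal (Real.exp (D * A x ^ n))) •
        gibbs S 0 (tilt ρ (a / 2) n) (fun _ _ => 0) (fun _ => 0) := by
  set N := ∫⁻ u, ENNReal.ofReal (Real.exp (a / 2 * |u| ^ n)) ∂ρ with hNdef
  set p := ρ (Set.Icc (-L) L) with hpdef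
  set Z := partitionFunction (S ∪ R) β ρ J ξ with hZdef
  have hZ0 : Z ≠ 0 := partitionFunction_ne_zero ρ hρ0 _ β J ξ
  have hZ1 : Z ≠ ∞ := partitionFunction_ne_top h hn ha ρ hρ _ hβ ξ
  refine Measure.le_iff.2 fun s hsm => ?_
  have hg : Measurable (s.indicator (1 : (S → ℝ) → ℝ≥0∞)) := measurable_one.indicator hsm
  have hmom : ∀ ζ : V → ℝ, (∀ z, z ∉ S → ζ z = ξ z) → MomentBound n J f ρ β C R ζ :=
    fun ζ hζ => momentBound h hn ha hρ hβ hC hε hβM hLC hp hεa hB R ζ fun y hy =>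
      (summable_of_eq_off (hs y (Finset.mem_union_right _ hy)) hζ).abs
  have key := lintegral_marginal_le h hn hSR hβ hC hε hβM hLC hp hs hA
    (fun ζ => partitionFunction_ne_top h hn ha ρ hρ R hβ ζ) (fun _ => hmom) hg
  rw [gibbs_map_restrict_apply S R β ρ J ξ hS hsm, Measure.smul_apply, smul_eq_mul,
    gibbs_free_apply S ρ (a / 2) n hN hsm]
  refine (mul_le_mul_right key _).trans ?_
  rw [← hZdef, mul_comm Z⁻¹, mul_assoc, ENNReal.mul_inv_cancel hZ0 hZ1, mul_one,
    ← lintegral_indicator hsm, ← mul_assoc, ENNReal.prod_inv_distrib (fun _ _ _ _ _ => Or.inl hN0),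
    ← Finset.prod_coe_sort S, ← Finset.prod_mul_distrib,
    ← lintegral_const_mul' _ _ (ENNReal.prod_ne_top fun _ _ =>
      ENNReal.mul_ne_top ENNReal.ofReal_ne_top (ENNReal.inv_ne_top.2 hN0))]
  refine lintegral_mono fun ψ => ?_
  by_cases hψ : ψ ∈ s
  · simp only [Set.indicator_of_mem hψ, Pi.one_apply, one_mul]
    rw [← Finset.prod_mul_distrib]
    refine Finset.prod_le_prod' fun x _ => ?_
    have hA1 := (hA x x.2).1
    set κ := (p⁻¹ * N).toReal with hκ
    -- Trades `p⁻¹` for the normalisation `N⁻¹` of the tilted measure, using `κ ≤ exp κ`. The factor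
    -- `exp κ` then goes into `exp (D * A x ^ n)` because `A x ≥ 1`.
    have hpN : p⁻¹ ≤ ENNReal.ofReal (Real.exp κ) * N⁻¹ := by
      have e1 : p⁻¹ = p⁻¹ * N * N⁻¹ := by
        rw [mul_assoc, ENNReal.mul_inv_cancel hN0 hN, mul_one]
      have e2 : p⁻¹ * N = ENNReal.ofReal κ :=
        (ENNReal.ofReal_toReal (ENNReal.mul_ne_top (ENNReal.inv_ne_top.2 hp) hN)).symm
      rw [e1, e2]
      gcongr
      linarith [Real.add_one_le_exp κ]
    refine (mul_le_mul_left hpN _).trans ?_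
    rw [mul_right_comm, ← ENNReal.ofReal_mul (Real.exp_pos _).le, ← Real.exp_add,
      mul_right_comm _ N⁻¹, ← ENNReal.ofReal_mul (Real.exp_pos _).le, ← Real.exp_add]
    gcongr ENNReal.ofReal (Real.exp ?_) * _
    have hAn : 1 ≤ A x ^ n := Real.one_le_rpow hA1 (by linarith)
    have hκ0 : 0 ≤ κ := ENNReal.toReal_nonneg
    have h2 : 0 ≤ |ψ x| ^ n := by positivity
    rw [Real.mul_rpow (by linarith) (by linarith)]
    have h3 := mul_le_mul_of_nonneg_right hD (by linarith : 0 ≤ A x ^ n)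
    have h4 : κ ≤ κ * A x ^ n := le_mul_of_one_le_right hκ0 hAn
    have h5 : 4 * ε ≤ a / 2 := by
      have : 0 ≤ (2 : ℝ) ^ n * ε := by positivity
      linarith
    have h6 := mul_le_mul_of_nonneg_right h5 h2
    nlinarith
  · simp [Set.indicator_of_notMem hψ]

end Normalisation

end SpinRegularity

/-! ### Choice of the constants -/

theorem theorem1p1 (n a : ℝ) (hn : 2 < n) (ha : 0 < a) (ρ : MeasureTheory.Measure ℝ)
    (hρ_pos : 0 < ∫⁻ u, ENNReal.ofReal (Real.exp (a * |u| ^ n)) ∂ρ)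
    (hρ_fin : ∫⁻ u, ENNReal.ofReal (Real.exp (a * |u| ^ n)) ∂ρ < ∞)
    (δ M : ℝ) (hδ : 0 < δ) (hM : 0 < M) :
    ∃ C₁ C₂ D₁ D₂ : ℝ, 0 ≤ C₁ ∧ 1 ≤ C₂ ∧ 0 ≤ D₁ ∧ 0 < D₂ ∧
      ∀ (V : Type u) [Countable V] (J : V → V → ℝ) (f : ℝ → ℝ),
        SpinRegularity.IsAdmissible n J f δ M →
      ∀ β C D : ℝ, 0 ≤ β → C = C₁ * β ^ (1 / (n - 2)) + C₂ → D = D₁ * β ^ (n / (n - 2)) + D₂ →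
      ∀ (Λ Λ' : Finset V) (hΛ : Λ' ⊆ Λ) (ξ : V → ℝ),
        (∀ x ∈ Λ, Summable fun y => |J x y * ξ y|) →
        MeasureTheory.IsProbabilityMeasure (SpinRegularity.gibbs Λ β ρ J ξ) ∧
        (∀ x ∈ Λ, SpinRegularity.boundaryGrowth n J f ξ C (Λ : Set V) x ≠ ∞) ∧
        (SpinRegularity.gibbs Λ β ρ J ξ).map (Finset.restrict₂ (π := fun _ : V => ℝ) hΛ) ≤
          (∏ x ∈ Λ', ENNReal.ofReal (Real.exp
            (D * (SpinRegularity.boundaryGrowth n J f ξ C (Λ : Set V) x).toReal ^ n))) •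
          SpinRegularity.gibbs Λ' 0 (SpinRegularity.tilt ρ (a / 2) n) (fun _ _ => 0)
            (fun _ => 0) := by
  have hρ0 : ρ ≠ 0 := by
    rintro rfl
    simp at hρ_pos
  have hpow : ∀ u : ℝ, 0 ≤ |u| ^ n := fun u => by positivity
  have hfinite : IsFiniteMeasure ρ := by
    refine ⟨lt_of_le_of_lt ?_ hρ_fin⟩
    rw [← lintegral_one]
    refine lintegral_mono fun u => ?_
    simpa using mul_nonneg ha.le (hpow u)
  set N := ∫⁻ u, ENNReal.ofReal (Real.exp (a / 2 * |u| ^ n)) ∂ρ with hNdef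
  have hN : N ≠ ∞ := by
    refine (lt_of_le_of_lt (lintegral_mono fun u => ?_) hρ_fin).ne
    refine ENNReal.ofReal_le_ofReal (Real.exp_le_exp.2 ?_)
    nlinarith [mul_nonneg ha.le (hpow u)]
  have hN0 : N ≠ 0 := by
    intro h0
    have h1 : ρ Set.univ ≤ N := by
      rw [← lintegral_one]
      refine lintegral_mono fun u => ?_
      simpa using mul_nonneg (by linarith : 0 ≤ a / 2) (hpow u)
    rw [h0] at h1
    exact hρ0 (Measure.measure_univ_eq_zero.1 (le_antisymm h1 zero_le))
  obtain ⟨L, hp⟩ := SpinRegularity.exists_Icc_measure_ne_zero hρ0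
  set p := ρ (Set.Icc (-(L : ℝ)) L) with hpdef
  set B := ∫⁻ u, ENNReal.ofReal (|u| * Real.exp (a / 2 * |u| ^ n)) ∂ρ with hBdef
  have hB : B ≠ ∞ := by
    obtain ⟨k, hk⟩ := SpinRegularity.exists_quadratic_le_rpow hn (half_pos ha) 1 zero_le_one
    have h1 : B ≤ ∫⁻ u, ENNReal.ofReal (Real.exp k) *
        ENNReal.ofReal (Real.exp (a * |u| ^ n)) ∂ρ := by
      refine lintegral_mono fun u => ?_
      rw [← ENNReal.ofReal_mul (Real.exp_pos _).le]
      refine ENNReal.ofReal_le_ofReal ?_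
      have h2 : |u| ≤ Real.exp (a / 2 * |u| ^ n + k) := by
        linarith [hk u, sq_nonneg u, Real.add_one_le_exp (a / 2 * |u| ^ n + k)]
      refine (mul_le_mul_of_nonneg_right h2 (Real.exp_pos _).le).trans (le_of_eq ?_)
      rw [← Real.exp_add, ← Real.exp_add]
      ring_nf
    rw [lintegral_const_mul' _ _ ENNReal.ofReal_ne_top] at h1
    exact (h1.trans_lt (ENNReal.mul_lt_top ENNReal.ofReal_lt_top hρ_fin)).ne
  have hq : (0 : ℝ) < 4 + 12 * 2 ^ n := by positivity
  -- The largest `ε` allowed by the tail estimate.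
  set ε := a / 2 / (4 + 12 * 2 ^ n) with hεdef
  have hε : 0 < ε := by positivity
  have hn2 : 0 < n - 2 := by linarith
  -- Chosen so that `ε * (C₁ * β ^ (1 / (n - 2))) ^ (n - 2) = β * M`. The terms of `C₂` ensure `1 ≤
  -- C`, `L ≤ C` and a tail moment of at most `C / 2`, respectively.
  set C₁ := (M / ε) ^ (1 / (n - 2)) with hC₁
  have hC₁0 : 0 ≤ C₁ := by positivity
  set C₂ := 1 + L + 2 * (p⁻¹ * B).toReal with hC₂
  have hpB : p⁻¹ * B ≠ ∞ := ENNReal.mul_ne_top (ENNReal.inv_ne_top.2 hp) hB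
  have hL0 : (0 : ℝ) ≤ L := Nat.cast_nonneg L
  have hT0 : 0 ≤ (p⁻¹ * B).toReal := ENNReal.toReal_nonneg
  have hC₂1 : 1 ≤ C₂ := by linarith
  set κ := (p⁻¹ * N).toReal with hκ
  have hκ0 : 0 ≤ κ := ENNReal.toReal_nonneg
  -- These come from `12 * ε * C ^ n + κ` by `(x + y) ^ n ≤ 2 ^ n * (x ^ n + y ^ n)`; the final `1`
  -- makes strict positivity immediate.
  refine ⟨C₁, C₂, 12 * ε * (2 ^ n * C₁ ^ n), 12 * ε * (2 ^ n * C₂ ^ n) + κ + 1, hC₁0, hC₂1,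
    by positivity, by positivity, ?_⟩
  intro V _ J f h β C D hβ hCeq hDeq Λ Λ' hΛ ξ hξ
  classical
  set b := β ^ (1 / (n - 2)) with hb
  have hb0 : 0 ≤ b := by positivity
  have hCC₂ : C₂ ≤ C := by
    rw [hCeq]; exact le_add_of_nonneg_left (mul_nonneg hC₁0 hb0)
  have hC : 1 ≤ C := hC₂1.trans hCC₂
  have hβM : β * M ≤ ε * C ^ (n - 2) := by
    have e1 : (C₁ * b) ^ (n - 2) = M / ε * β := by
      rw [Real.mul_rpow hC₁0 hb0, hC₁, hb, ← Real.rpow_mul (by positivity), ← Real.rpow_mul hβ,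
        one_div_mul_cancel hn2.ne', Real.rpow_one, Real.rpow_one]
    have e2 : (C₁ * b) ^ (n - 2) ≤ C ^ (n - 2) :=
      Real.rpow_le_rpow (mul_nonneg hC₁0 hb0) (by linarith) hn2.le
    rw [e1] at e2
    have e3 := mul_le_mul_of_nonneg_left e2 hε.le
    have e4 : ε * (M / ε * β) = β * M := by field_simp
    linarith
  have hD : 12 * ε * C ^ n + κ ≤ D := by
    have e1 : b ^ n = β ^ (n / (n - 2)) := by
      rw [hb, ← Real.rpow_mul hβ]
      ring_nf
    have e2 := SpinRegularity.add_rpow_le_two_rpow_mul (by linarith : 0 ≤ n)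
      (mul_nonneg hC₁0 hb0) (by linarith : 0 ≤ C₂)
    rw [← hCeq, Real.mul_rpow hC₁0 hb0, e1] at e2
    have e3 := mul_le_mul_of_nonneg_left e2 (by positivity : 0 ≤ 12 * ε)
    rw [hDeq]
    linarith
  have hgrowth := fun x =>
    SpinRegularity.boundaryGrowth_ne_top_and_admitsBound h hn hC Λ ξ x
  refine ⟨SpinRegularity.isProbabilityMeasure_gibbs Λ β ρ J ξ
    (SpinRegularity.partitionFunction_ne_zero ρ hρ0 _ β J ξ)
    (SpinRegularity.partitionFunction_ne_top h hn ha ρ hρ_fin _ hβ ξ),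
    fun x _ => (hgrowth x).1, ?_⟩
  obtain ⟨R, hR, rfl⟩ : ∃ R, Disjoint Λ' R ∧ Λ = Λ' ∪ R :=
    ⟨Λ \ Λ', Finset.disjoint_sdiff, (Finset.union_sdiff_of_subset hΛ).symm⟩
  refine SpinRegularity.gibbs_map_restrict_le h hn ha hρ0 hρ_fin hR hβ hC hε.le hβM
    (by linarith : (L : ℝ) ≤ C) hp (le_of_eq (by rw [hεdef]; field_simp)) ?_ hN0 hN hD hξ
    (fun x _ => (hgrowth x).2) hΛ
  rw [← ENNReal.ofReal_toReal hpB]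
  exact ENNReal.ofReal_le_ofReal (by linarith)
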